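/- Weighted Component Order Connectivity is the following decision problem. Given a finite simple undirected graph $G$ on $n$ vertices, a weight function $w:V(G)\to\mathbb{N}=\{0,1,\dots\}$ and two integers $k,\ell\ge 0$, decide whether there is a set $X\subseteq V(G)$ with $\sum_{v\in X}w(v)\le k$ such that every connected component of $G-X$ has weight at most $\ell$ (the weight of a component being the sum of the weights of its vertices). An interval graph is the intersection graph of a finite family of non-empty intervals of the real line. Theorem. Weighted Component Order Connectivity can be solved in $O(\min\{k,\ell\}\cdot n^3)$ time on interval graphs. Precisely: there are a single program $P$ for a unit-cost random access machine and a constant $C$ such that, for every interval graph $G$ with vertex set $\{0,\dots,n-1\}$, every $w:V(G)\to\mathbb{N}$ and all integers $k,\ell\ge 0$, the program $P$, given $n$, $k$, $\ell$, the list of vertex weights and the adjacency matrix of $G$ (no interval representation is given), halts after at most $$C\cdot\max\{1,\min\{k,\ell\}\}\cdot\max\{1,n\}^3$$ steps and outputs $1$ if $(G,w,k,\ell)$ is a yes-instance and $0$ otherwise. The machine has registers and arrays holding natural numbers, and its unit-cost operations are addition, truncated subtraction, tests for zero, reading, writing and indirect addressing of array entries; multiplication and bitwise operations are not available. -/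

import Mathlib

namespace WCOC

/-! ## Graphs -/

/-- A graph is an interval graph if it is the intersection graph of a family of non-empty
intervals (order-connected sets) of the real line. -/
def IsIntervalGraph {V : Type*} (G : SimpleGraph V) : Prop :=
  ∃ I : V → Set ℝ, (∀ v, (I v).OrdConnected ∧ (I v).Nonempty) ∧
    ∀ u v, u ≠ v → (G.Adj u v ↔ (I u ∩ I v).Nonempty)

open Classical in
/-- The weight of a heaviest connected component of a finite graph
(`0` for the graph without vertices). -/
noncomputable def heaviestComponent {V : Type*} [Fintype V] (G : SimpleGraph V) (w : V → ℕ) : ℕ :=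
  (Finset.univ : Finset G.ConnectedComponent).sup
    fun C => ∑ v with G.connectedComponentMk v = C, w v

/-- `(G, w, k, l)` is a yes-instance of Weighted Component Order Connectivity: there is a vertex
set `X` of weight at most `k` such that every component of `G - X` has weight at most `l`. -/
def IsYesInstance {V : Type*} [Fintype V] [DecidableEq V] (G : SimpleGraph V) (w : V → ℕ)
    (k l : ℕ) : Prop :=
  ∃ X : Finset V, ∑ v ∈ X, w v ≤ k ∧
    heaviestComponent (G.induce {v | v ∉ X}) (fun v => w v.1) ≤ l

/-! ## The machine model: a unit-cost RAM with addition and truncated subtraction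

Programs are structured (sequencing, branching, `while`). A program mentions finitely many
registers and finitely many arrays, by their literal names; arrays are addressed indirectly, by
computed indices. Every operation, memory access, assignment and test costs one step. There is no
multiplication and no bitwise operation. -/

/-- The contents of the registers and of the arrays. -/
structure State where
  reg : ℕ → ℕ
  arr : ℕ → ℕ → ℕ

/-- Expressions: literals, registers, array entries, sums and truncated differences. -/
inductive Expr : Type
  | lit (c : ℕ)
  | reg (x : ℕ)
  | get (a : ℕ) (i : Expr)
  | add (e₁ e₂ : Expr)
  | sub (e₁ e₂ : Expr)

/-- The value of an expression. -/
def Expr.eval (s : State) : Expr → ℕ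
  | .lit c => c
  | .reg x => s.reg x
  | .get a i => s.arr a (i.eval s)
  | .add e₁ e₂ => e₁.eval s + e₂.eval s
  | .sub e₁ e₂ => e₁.eval s - e₂.eval s

/-- The number of steps taken by the evaluation of an expression. -/
def Expr.cost : Expr → ℕ
  | .lit _ => 1
  | .reg _ => 1
  | .get _ i => i.cost + 1
  | .add e₁ e₂ => e₁.cost + e₂.cost + 1
  | .sub e₁ e₂ => e₁.cost + e₂.cost + 1

/-- Programs. Tests succeed when the tested expression is non-zero. -/
inductive Cmd : Type
  | skip
  | assign (x : ℕ) (e : Expr)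
  | store (a : ℕ) (i e : Expr)
  | seq (c₁ c₂ : Cmd)
  | ite (b : Expr) (c₁ c₂ : Cmd)
  | while (b : Expr) (c : Cmd)

/-- Writing a register. -/
def State.setReg (s : State) (x v : ℕ) : State :=
  { s with reg := Function.update s.reg x v }

/-- Writing an array entry. -/
def State.setArr (s : State) (a i v : ℕ) : State :=
  { s with arr := Function.update s.arr a (Function.update (s.arr a) i v) }

/-- `Exec c s t s'`: started in `s`, the program `c` halts in `s'` after exactly `t` steps. -/
inductive Exec : Cmd → State → ℕ → State → Prop
  | skip (s : State) : Exec .skip s 1 s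
  | assign (x : ℕ) (e : Expr) (s : State) :
      Exec (.assign x e) s (e.cost + 1) (s.setReg x (e.eval s))
  | store (a : ℕ) (i e : Expr) (s : State) :
      Exec (.store a i e) s (i.cost + e.cost + 1) (s.setArr a (i.eval s) (e.eval s))
  | seq {c₁ c₂ : Cmd} {s s₁ s₂ : State} {t₁ t₂ : ℕ} :
      Exec c₁ s t₁ s₁ → Exec c₂ s₁ t₂ s₂ → Exec (.seq c₁ c₂) s (t₁ + t₂) s₂
  | ite_true {b : Expr} {c₁ c₂ : Cmd} {s s' : State} {t : ℕ} :
      b.eval s ≠ 0 → Exec c₁ s t s' → Exec (.ite b c₁ c₂) s (b.cost + 1 + t) s'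
  | ite_false {b : Expr} {c₁ c₂ : Cmd} {s s' : State} {t : ℕ} :
      b.eval s = 0 → Exec c₂ s t s' → Exec (.ite b c₁ c₂) s (b.cost + 1 + t) s'
  | while_true {b : Expr} {c : Cmd} {s s₁ s₂ : State} {t₁ t₂ : ℕ} :
      b.eval s ≠ 0 → Exec c s t₁ s₁ → Exec (.while b c) s₁ t₂ s₂ →
      Exec (.while b c) s (b.cost + 1 + t₁ + t₂) s₂
  | while_false {b : Expr} {c : Cmd} {s : State} :
      b.eval s = 0 → Exec (.while b c) s (b.cost + 1) s

/-- The machine is deterministic: final state and running time are determined by the program and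
the initial state. -/
theorem Exec.deterministic {c : Cmd} {s s₁ s₂ : State} {t₁ t₂ : ℕ}
    (h₁ : Exec c s t₁ s₁) (h₂ : Exec c s t₂ s₂) : t₁ = t₂ ∧ s₁ = s₂ := by
  induction h₁ generalizing t₂ s₂ with
  | skip s => cases h₂; exact ⟨rfl, rfl⟩
  | assign x e s => cases h₂; exact ⟨rfl, rfl⟩
  | store a i e s => cases h₂; exact ⟨rfl, rfl⟩
  | seq _ _ ih₁ ih₂ =>
    cases h₂ with
    | seq k₁ k₂ =>
      obtain ⟨rfl, rfl⟩ := ih₁ k₁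
      obtain ⟨rfl, rfl⟩ := ih₂ k₂
      exact ⟨rfl, rfl⟩
  | ite_true hb _ ih =>
    cases h₂ with
    | ite_true _ k => obtain ⟨rfl, rfl⟩ := ih k; exact ⟨rfl, rfl⟩
    | ite_false hb' _ => exact absurd hb' hb
  | ite_false hb _ ih =>
    cases h₂ with
    | ite_true hb' _ => exact absurd hb hb'
    | ite_false _ k => obtain ⟨rfl, rfl⟩ := ih k; exact ⟨rfl, rfl⟩
  | while_true hb _ _ ih₁ ih₂ =>
    cases h₂ with
    | while_true _ k₁ k₂ =>
      obtain ⟨rfl, rfl⟩ := ih₁ k₁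
      obtain ⟨rfl, rfl⟩ := ih₂ k₂
      exact ⟨rfl, rfl⟩
    | while_false hb' => exact absurd hb' hb
  | while_false hb =>
    cases h₂ with
    | while_true hb' _ _ => exact absurd hb hb'
    | while_false _ => exact ⟨rfl, rfl⟩

open Classical in
/-- The encoding of an instance `(G, w, k, l)` with vertex set `{0, …, n - 1}`: registers `0, 1, 2`
hold `n`, `k`, `l`; array `0` holds the weights; array `1` holds the adjacency matrix, row by row;
everything else is `0`. -/
noncomputable def inputState {n : ℕ} (G : SimpleGraph (Fin n)) (w : Fin n → ℕ) (k l : ℕ) :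
    State where
  reg x := if x = 0 then n else if x = 1 then k else if x = 2 then l else 0
  arr a i :=
    if a = 0 then (if h : i < n then w ⟨i, h⟩ else 0)
    else if a = 1 then
      (if ∃ u v : Fin n, i = u.1 * n + v.1 ∧ G.Adj u v then 1 else 0)
    else 0

/-- `P` decides the instance `(G, w, k, l)` in at most `T` steps: it halts within `T` steps, with
`1` in register `0` if the instance is a yes-instance and with `0` there otherwise. -/
def DecidesWithin (P : Cmd) {n : ℕ} (G : SimpleGraph (Fin n)) (w : Fin n → ℕ) (k l T : ℕ) : Prop :=
  ∃ (t : ℕ) (s : State), Exec P (inputState G w k l) t s ∧ t ≤ T ∧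
    (IsYesInstance G w k l → s.reg 0 = 1) ∧ (¬ IsYesInstance G w k l → s.reg 0 = 0)

end WCOC

namespace WCOC

/-! In an interval graph the relation "entirely to the left of" is a transitive orientation of the
complement. Conversely, every transitive orientation of the complement of an interval graph gives a
representation. So it suffices to orient the complement, read off end points and run a dynamic
program over positions.

Orientation. If `(a, b)` is oriented, `a x` is a non-edge of the graph and `b x` is not, then `(a,
x)` has to be oriented too. The program closes the set of oriented pairs under this forcing and
under transitivity. When nothing is pending, it orients the next undecided non-edge arbitrarily. No
choice is ever revoked, because any undecided non-edge can be added in either direction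
(`PartialOrientation.extend`, resting on `Forced.triangle`). Each oriented pair enters a queue once
and is processed in linear time, so this part is cubic.

Representation. The absence of induced four-cycles makes the successor sets nested
(`IsIntervalGraph.nested`). Hence the numbers of successors order the right ends, and the left end
of a vertex is the least right end in its closed neighbourhood (`IsIntervalGraph.isRepresentation`).
All end points are less than `n`.

Cuts. The cut `t` lies between the positions `t - 1` and `t`, and is usable for `X` if `X` contains
all intervals through it. No remaining component crosses a usable cut, and between consecutive
usable cuts the remaining intervals are linked (`reachable_of_no_cut`). So feasibility is a
condition on the weights left between cuts (`isYesInstance_iff`). The least cost up to `t` satisfies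
a recurrence over the preceding cut `s` (`achievable_iff`): the cost up to `s`, the intervals that
begin after `s` and cross `t`, and a deletion inside the region between them. The last item is a
subset sum problem. Kept weights above `l` and deleted weights above `k` are irrelevant, so
tabulating the kind with the smaller bound needs `min k l + 1` entries (`achievable_iff_of_le`).
With quadratically many pairs of cuts and `n` items for each, this gives the time bound.

The program fragments are verified with `Prog.run_loop`. Their loops are bounded by registers that
stay fixed, so `Prog.exec_compile` bounds the running time by a polynomial computed from the syntax.
-/

/-! ## A language with `for` loops -/

/-- Programs whose only loops are `for` loops over a register-bounded range. -/
inductive Prog : Type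
  | assign (x : ℕ) (e : Expr)
  | store (a : ℕ) (i e : Expr)
  | seq (p q : Prog)
  | ite (b : Expr) (p q : Prog)
  | skip
  | loop (x r : ℕ) (p : Prog)

namespace Prog

/-- Translation into machine programs; `loop x r p` runs `p` for `x = 0, …, reg r - 1`. -/
def compile : Prog → Cmd
  | assign x e => .assign x e
  | store a i e => .store a i e
  | seq p q => .seq p.compile q.compile
  | ite b p q => .ite b p.compile q.compile
  | skip => .skip
  | loop x r p => .seq (.assign x (.lit 0))
      (.while (.sub (.reg r) (.reg x)) (.seq p.compile (.assign x (.add (.reg x) (.lit 1)))))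

/-- The result of `i` rounds of a loop with counter `x` and body `f`. -/
def iter (x : ℕ) (f : State → State) (s : State) : ℕ → State
  | 0 => s.setReg x 0
  | i + 1 => (f (iter x f s i)).setReg x (i + 1)

/-- The final state of a program. -/
def run : Prog → State → State
  | assign x e, s => s.setReg x (e.eval s)
  | store a i e, s => s.setArr a (i.eval s) (e.eval s)
  | seq p q, s => q.run (p.run s)
  | ite b p q, s => if b.eval s ≠ 0 then p.run s else q.run s
  | skip, s => s
  | loop x r p, s => iter x p.run s (s.reg r)

/-- Whether a program may write register `y`. -/
def writesReg (y : ℕ) : Prog → Bool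
  | assign x _ => x == y
  | store _ _ _ => false
  | seq p q => p.writesReg y || q.writesReg y
  | ite _ p q => p.writesReg y || q.writesReg y
  | skip => false
  | loop x _ p => x == y || p.writesReg y

/-- Whether a program may write array `y`. -/
def writesArr (y : ℕ) : Prog → Bool
  | assign _ _ => false
  | store a _ _ => a == y
  | seq p q => p.writesArr y || q.writesArr y
  | ite _ p q => p.writesArr y || q.writesArr y
  | skip => false
  | loop _ _ p => p.writesArr y

/-- Loop bodies change neither the counter nor the bound of their loop. -/
def WellFormed : Prog → Bool
  | assign _ _ => true
  | store _ _ _ => true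
  | seq p q => p.WellFormed && q.WellFormed
  | ite _ p q => p.WellFormed && q.WellFormed
  | skip => true
  | loop x r p => p.WellFormed && !p.writesReg x && !p.writesReg r && !(x == r)

/-- No register bounding a loop of the program is among those written, according to `wr`. -/
def BoundsFixed (wr : ℕ → Bool) : Prog → Bool
  | assign _ _ => true
  | store _ _ _ => true
  | seq p q => p.BoundsFixed wr && q.BoundsFixed wr
  | ite _ p q => p.BoundsFixed wr && q.BoundsFixed wr
  | skip => true
  | loop _ r p => p.BoundsFixed wr && !wr r

/-- A bound on the running time, where `ρ` bounds the registers that bound the loops. -/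
def time (ρ : ℕ → ℕ) : Prog → ℕ
  | assign _ e => e.cost + 1
  | store _ i e => i.cost + e.cost + 1
  | seq p q => p.time ρ + q.time ρ
  | ite b p q => b.cost + 1 + (p.time ρ + q.time ρ)
  | skip => 1
  | loop _ r p => 6 + ρ r * (p.time ρ + 8)

end Prog

/-! ### Framing, the loop rule and the cost of compiled programs -/

@[simp] theorem State.reg_setReg (s : State) (x v y : ℕ) :
    (s.setReg x v).reg y = if y = x then v else s.reg y := by
  simp [State.setReg, Function.update_apply]

@[simp] theorem State.arr_setReg (s : State) (x v : ℕ) : (s.setReg x v).arr = s.arr := rfl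

@[simp] theorem State.reg_setArr (s : State) (a i v : ℕ) : (s.setArr a i v).reg = s.reg := rfl

theorem State.arr_setArr (s : State) (a i v b : ℕ) :
    (s.setArr a i v).arr b = if b = a then Function.update (s.arr a) i v else s.arr b := by
  simp [State.setArr, Function.update_apply]

@[simp] theorem State.arr_setArr_apply (s : State) (a i v b j : ℕ) :
    (s.setArr a i v).arr b j = if b = a ∧ j = i then v else s.arr b j := by
  rw [State.arr_setArr]
  by_cases h : b = a
  · subst h; simp [Function.update_apply]
  · simp [h]

attribute [simp] Expr.eval

namespace Prog

theorem run_ite_pos {b : Expr} {s : State} (h : b.eval s ≠ 0) (p q : Prog) :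
    (ite b p q).run s = p.run s := if_pos h

theorem run_ite_neg {b : Expr} {s : State} (h : b.eval s = 0) (p q : Prog) :
    (ite b p q).run s = q.run s := if_neg (not_not.2 h)

/-- The hypothesis is a computable check on the syntax, so for a concrete program and register it is
discharged by `rfl`. -/
theorem run_reg {p : Prog} {y : ℕ} (h : p.writesReg y = false) (s : State) :
    (p.run s).reg y = s.reg y := by
  induction p generalizing s with
  | assign x e =>
    have : y ≠ x := by rintro rfl; simp [writesReg] at h
    simp [run, this]
  | store a i e => rfl
  | seq p q ihp ihq =>
    simp only [writesReg, Bool.or_eq_false_iff] at h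
    simp [run, ihp h.1, ihq h.2]
  | ite b p q ihp ihq =>
    simp only [writesReg, Bool.or_eq_false_iff] at h
    by_cases hb : b.eval s = 0 <;> simp [run, hb, ihp h.1, ihq h.2]
  | skip => rfl
  | loop x r p ih =>
    simp only [writesReg, Bool.or_eq_false_iff, beq_eq_false_iff_ne] at h
    have key : ∀ i, (iter x p.run s i).reg y = s.reg y := by
      intro i
      induction i with
      | zero => simp [iter, h.1.symm]
      | succ i hi => simp [iter, h.1.symm, ih h.2, hi]
    exact key _

theorem run_arr {p : Prog} {y : ℕ} (h : p.writesArr y = false) (s : State) :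
    (p.run s).arr y = s.arr y := by
  induction p generalizing s with
  | assign x e => rfl
  | store a i e =>
    have : y ≠ a := by rintro rfl; simp [writesArr] at h
    simp [run, State.arr_setArr, this]
  | seq p q ihp ihq =>
    simp only [writesArr, Bool.or_eq_false_iff] at h
    simp [run, ihp h.1, ihq h.2]
  | ite b p q ihp ihq =>
    simp only [writesArr, Bool.or_eq_false_iff] at h
    by_cases hb : b.eval s = 0 <;> simp [run, hb, ihp h.1, ihq h.2]
  | skip => rfl
  | loop x r p ih =>
    have key : ∀ i, (iter x p.run s i).arr y = s.arr y := by
      intro i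
      induction i with
      | zero => simp [iter]
      | succ i hi => simp [iter, ih h, hi]
    exact key _

/-- The states `s'` that agree with `s` on everything `p` does not write. -/
structure Frame (p : Prog) (s s' : State) : Prop where
  reg : ∀ y, p.writesReg y = false → s'.reg y = s.reg y
  arr : ∀ y, p.writesArr y = false → s'.arr y = s.arr y

theorem frame_run (p : Prog) (s : State) : p.Frame s (p.run s) :=
  ⟨fun _ h => run_reg h s, fun _ h => run_arr h s⟩

/-- The invariant rule for loops. -/
theorem run_loop {x r : ℕ} {p : Prog} (I : ℕ → State → Prop) (s : State)
    (h0 : I 0 (s.setReg x 0))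
    (hs : ∀ i < s.reg r, ∀ s', (loop x r p).Frame s s' → s'.reg x = i → I i s' →
      I (i + 1) ((p.run s').setReg x (i + 1))) :
    I (s.reg r) ((loop x r p).run s) := by
  -- The frame and the counter value are carried along with the invariant, so that an invariant need
  -- only mention what the body changes.
  have key : ∀ i ≤ s.reg r, (loop x r p).Frame s (iter x p.run s i) ∧
      (iter x p.run s i).reg x = i ∧ I i (iter x p.run s i) := by
    intro i
    induction i with
    | zero =>
      refine fun _ => ⟨⟨fun y hy => ?_, fun y hy => rfl⟩, by simp [iter], h0⟩
      simp only [writesReg, Bool.or_eq_false_iff, beq_eq_false_iff_ne] at hy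
      simp [iter, hy.1.symm]
    | succ i ih =>
      intro hi
      obtain ⟨hF, hr, hI⟩ := ih (by omega)
      refine ⟨⟨fun y hy => ?_, fun y hy => ?_⟩, by simp [iter], hs i (by omega) _ hF hr hI⟩
      · have hy' := hy
        simp only [writesReg, Bool.or_eq_false_iff, beq_eq_false_iff_ne] at hy'
        simp [iter, hy'.1.symm, run_reg hy'.2, hF.reg y hy]
      · have hy' : p.writesArr y = false := hy
        simp [iter, run_arr hy', hF.arr y hy]
  exact (key _ le_rfl).2.2

/-- The predicate `wr` over-approximates the registers written by the whole program and stays fixed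
while the induction descends into subprograms. A loop bound outside `wr` keeps its initial value, so
the bound `ρ` remains valid whenever a loop is entered. -/
theorem exec_compile {p : Prog} (hp : p.WellFormed = true) {wr : ℕ → Bool}
    (hb : p.BoundsFixed wr = true) (hw : ∀ y, wr y = false → p.writesReg y = false)
    {ρ : ℕ → ℕ} {s : State} (hρ : ∀ y, wr y = false → s.reg y ≤ ρ y) :
    ∃ t, Exec p.compile s t (p.run s) ∧ t ≤ p.time ρ := by
  induction p generalizing s with
  | assign x e => exact ⟨_, .assign x e s, le_rfl⟩
  | store a i e => exact ⟨_, .store a i e s, le_rfl⟩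
  | seq p q ihp ihq =>
    simp only [WellFormed, BoundsFixed, writesReg, Bool.and_eq_true, Bool.or_eq_false_iff]
      at hp hb hw
    obtain ⟨t₁, h₁, l₁⟩ := ihp hp.1 hb.1 (fun y hy => (hw y hy).1) hρ
    obtain ⟨t₂, h₂, l₂⟩ := ihq hp.2 hb.2 (fun y hy => (hw y hy).2) (s := p.run s)
      (fun y hy => by rw [run_reg (hw y hy).1]; exact hρ y hy)
    exact ⟨_, .seq h₁ h₂, by simp only [time]; omega⟩
  | ite b p q ihp ihq =>
    simp only [WellFormed, BoundsFixed, writesReg, Bool.and_eq_true, Bool.or_eq_false_iff]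
      at hp hb hw
    by_cases h : b.eval s = 0
    · obtain ⟨t, h₁, l₁⟩ := ihq hp.2 hb.2 (fun y hy => (hw y hy).2) hρ
      refine ⟨_, ?_, (?_ : b.cost + 1 + t ≤ _)⟩
      · simpa [run, h, compile] using Exec.ite_false (c₁ := p.compile) h h₁
      · simp only [time]; omega
    · obtain ⟨t, h₁, l₁⟩ := ihp hp.1 hb.1 (fun y hy => (hw y hy).1) hρ
      refine ⟨_, ?_, (?_ : b.cost + 1 + t ≤ _)⟩
      · simpa [run, h, compile] using Exec.ite_true (c₂ := q.compile) h h₁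
      · simp only [time]; omega
  | skip => exact ⟨_, .skip s, le_rfl⟩
  | loop x r p ih =>
    simp only [WellFormed, BoundsFixed, writesReg, Bool.and_eq_true, Bool.or_eq_false_iff,
      Bool.not_eq_true', beq_eq_false_iff_ne] at hp hb hw
    obtain ⟨⟨⟨hp, hpx⟩, hpr⟩, hxr⟩ := hp
    obtain ⟨hb, hwr⟩ := hb
    have hreg : ∀ i, (iter x p.run s i).reg x = i := fun i => by cases i <;> simp [iter]
    have hregy : ∀ y, x ≠ y → p.writesReg y = false → ∀ i,
        (iter x p.run s i).reg y = s.reg y := by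
      intro y hxy hy i
      induction i with
      | zero => simp [iter, hxy.symm]
      | succ i hi => simp [iter, hxy.symm, run_reg hy, hi]
    -- Executions of `while` unfold from the first round while `iter` grows at the last one, hence
    -- the induction on the number `d` of remaining rounds. A round costs 8 besides its body (4 for
    -- the test, 4 for the increment). The failing test costs 4, which together with 2 for resetting
    -- the counter makes the 6 in `time`.
    have key : ∀ d i, i + d = s.reg r → ∃ t, Exec (.while (.sub (.reg r) (.reg x))
        (.seq p.compile (.assign x (.add (.reg x) (.lit 1))))) (iter x p.run s i) t
          (iter x p.run s (s.reg r)) ∧ t ≤ d * (p.time ρ + 8) + 4 := by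
      intro d
      induction d with
      | zero =>
        rintro i hi
        obtain rfl : i = s.reg r := by omega
        refine ⟨_, .while_false ?_, ?_⟩
        · simp [hreg, hregy r hxr hpr]
        · simp [Expr.cost]
      | succ d ihd =>
        intro i hi
        obtain ⟨t₁, h₁, l₁⟩ := ih hp hb (fun y hy => (hw y hy).2) (s := iter x p.run s i)
          (fun y hy => by rw [hregy y (hw y hy).1 (hw y hy).2]; exact hρ y hy)
        obtain ⟨t₂, h₂, l₂⟩ := ihd (i + 1) (by omega)
        have h₃ : Exec (.assign x (.add (.reg x) (.lit 1))) (p.run (iter x p.run s i)) 4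
            (iter x p.run s (i + 1)) := by
          have := Exec.assign x (.add (.reg x) (.lit 1)) (p.run (iter x p.run s i))
          simpa [iter, run_reg hpx, hreg, Expr.cost] using this
        refine ⟨_, .while_true ?_ (.seq h₁ h₃) h₂, ?_⟩
        · simp only [Expr.eval, hreg, hregy r hxr hpr]; omega
        · simp only [Expr.cost, Nat.succ_mul]; omega
    obtain ⟨t, h, l⟩ := key (s.reg r) 0 (by omega)
    refine ⟨_, .seq (.assign x (.lit 0) s) h, ?_⟩
    have := Nat.mul_le_mul_right (p.time ρ + 8) (hρ r hwr)
    simp only [Expr.cost, time]; omega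

end Prog

/-! ## Transitive orientations

`H` is a symmetric irreflexive relation (a graph). An orientation of some of its edges is closed
under forcing if an oriented edge forces the orientation of every edge with which it forms an
induced path of length two. -/

section Orientation

variable {V : Type*} {H : V → V → Prop}

/-- Closed under forcing. -/
structure ForcingClosed (H D : V → V → Prop) : Prop where
  right : ∀ {a b x}, D a b → H a x → ¬ H b x → D a x
  left : ∀ {a b x}, D a b → H x b → ¬ H x a → D x b

/-- A partial transitive orientation that is closed under forcing. -/
structure PartialOrientation (H D : V → V → Prop) : Prop extends ForcingClosed H D where
  edge : ∀ {a b}, D a b → H a b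
  trans : ∀ {a b c}, D a b → D b c → D a c
  irrefl : ∀ a, ¬ D a a

theorem PartialOrientation.asymm {D : V → V → Prop} (h : PartialOrientation H D) {a b : V}
    (hab : D a b) : ¬ D b a := fun hba => h.irrefl _ (h.trans hab hba)

/-- The pairs whose orientation is forced by the orientation `(a, b)`. -/
inductive Forced (H : V → V → Prop) (a b : V) : V → V → Prop
  | base : Forced H a b a b
  | right {c d x} : Forced H a b c d → H c x → ¬ H d x → Forced H a b c x
  | left {c d x} : Forced H a b c d → H x d → ¬ H x c → Forced H a b x d

theorem Forced.closed (a b : V) : ForcingClosed H (Forced H a b) := ⟨.right, .left⟩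

theorem Forced.subset {D : V → V → Prop} (hD : ForcingClosed H D) {a b c d : V}
    (h : Forced H a b c d) (hab : D a b) : D c d := by
  induction h with
  | base => exact hab
  | right _ h₁ h₂ ih => exact hD.right ih h₁ h₂
  | left _ h₁ h₂ ih => exact hD.left ih h₁ h₂

theorem Forced.edge {a b c d : V} (hab : H a b) (h : Forced H a b c d) : H c d := by
  cases h <;> assumption

/-- A forcing step is undone by a step of the same kind, since its conditions are symmetric in the
two edges of the induced path. Forcing is thus an equivalence relation on oriented edges. -/
theorem Forced.symm (hs : ∀ {a b}, H a b → H b a) {a b c d : V} (hab : H a b)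
    (h : Forced H a b c d) : Forced H c d a b := by
  induction h with
  | base => exact .base
  | @right c d x h₀ h₁ h₂ ih =>
    exact Forced.subset (Forced.closed _ _) ih
      (.right .base (h₀.edge hab) fun h => h₂ (hs h))
  | @left c d x h₀ h₁ h₂ ih =>
    exact Forced.subset (Forced.closed _ _) ih
      (.left .base (h₀.edge hab) fun h => h₂ (hs h))

variable (hs : ∀ {a b}, H a b → H b a) (hi : ∀ a, ¬ H a a)
include hs hi

/-- The triangle lemma. -/
theorem Forced.triangle {e f a b c b' c' : V} (hef : H e f) (hbc : Forced H e f b c)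
    (hab : H a b) (hac : H a c) (nac : ¬ Forced H e f a c) (nba : ¬ Forced H e f b a)
    (h : Forced H e f b' c') : a ≠ b' ∧ a ≠ c' := by
  -- By symmetry the class is also generated from `(b, c)`. The five conditions below hold there and
  -- survive each forcing step: if `a` were not adjacent to the new end point, the new pair would
  -- force a pair that is excluded.
  have h' : Forced H b c b' c' := Forced.subset (Forced.closed _ _) h (hbc.symm hs hef)
  suffices H a b' ∧ H a c' ∧ ¬ Forced H e f a c' ∧ ¬ Forced H e f b' a ∧ Forced H e f b' c' from
    ⟨fun h => hi _ (h ▸ this.1), fun h => hi _ (h ▸ this.2.1)⟩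
  clear h
  induction h' with
  | base => exact ⟨hab, hac, nac, nba, hbc⟩
  | right _ h₁ h₂ ih =>
    obtain ⟨i₁, i₂, i₃, i₄, i₅⟩ := ih
    have h₅ := i₅.right h₁ h₂
    refine ⟨i₁, ?_, fun h => i₃ (h.right i₂ fun h => h₂ (hs h)), i₄, h₅⟩
    by_contra h
    exact i₄ (h₅.right (hs i₁) fun h' => h (hs h'))
  | left _ h₁ h₂ ih =>
    obtain ⟨i₁, i₂, i₃, i₄, i₅⟩ := ih
    have h₅ := i₅.left h₁ h₂
    refine ⟨?_, i₂, i₃, fun h => i₄ (h.left (hs i₁) fun h => h₂ (hs h)), h₅⟩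
    by_contra h
    exact i₃ (h₅.left i₂ h)

/-- Every unoriented edge can be added to a partial transitive orientation of a comparability
graph. -/
theorem PartialOrientation.extend {R D : V → V → Prop} (hR : PartialOrientation H R)
    (hRt : ∀ {a b}, H a b → R a b ∨ R b a) (hD : PartialOrientation H D) {e f : V}
    (hef : H e f) (nef : ¬ D e f) (nfe : ¬ D f e) :
    ∃ D', PartialOrientation H D' ∧ (∀ a b, D a b → D' a b) ∧ D' e f := by
  -- `D` and its reverse are both closed under forcing, so if either met the class of `(e, f)` it
  -- would contain `(e, f)` itself.
  have hBD : ∀ {a b}, Forced H e f a b → ¬ D a b := fun h h' =>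
    nef (Forced.subset hD.toForcingClosed (h.symm hs hef) h')
  have hDr : ForcingClosed H fun a b => D b a :=
    ⟨fun h₁ h₂ h₃ => hD.left h₁ (hs h₂) fun h => h₃ (hs h),
      fun h₁ h₂ h₃ => hD.right h₁ (hs h₂) fun h => h₃ (hs h)⟩
  have hRr : ForcingClosed H fun a b => R b a :=
    ⟨fun h₁ h₂ h₃ => hR.left h₁ (hs h₂) fun h => h₃ (hs h),
      fun h₁ h₂ h₃ => hR.right h₁ (hs h₂) fun h => h₃ (hs h)⟩
  have hBD' : ∀ {a b}, Forced H e f a b → ¬ D b a := fun h h' =>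
    nfe (Forced.subset hDr (h.symm hs hef) h')
  have hBas : ∀ {a b}, Forced H e f a b → ¬ Forced H e f b a := by
    intro a b h₁ h₂
    -- The class lies entirely in `R` or entirely in its reverse, and both are asymmetric.
    rcases hRt hef with h | h
    · exact hR.asymm (h₁.subset hR.toForcingClosed h) (h₂.subset hR.toForcingClosed h)
    · exact hR.asymm (h₁.subset hRr h) (h₂.subset hRr h)
  have hside : ∀ {a b c}, Forced H e f b c → H a b → ¬ Forced H e f b a → H a c := by
    intro a b c hbc hab nba
    by_contra h
    exact nba (hbc.right (hs hab) fun h' => h (hs h'))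
  have hBtr : ∀ {a b c}, Forced H e f a b → Forced H e f b c → Forced H e f a c := by
    intro a b c hab hbc
    by_contra nac
    -- If `(a, c)` were not forced, the triangle lemma would keep `a` out of all pairs of the class,
    -- but `(a, b)` is one of them. The next step uses `(y, a)` in the same way.
    have h₁ := hab.edge hef
    exact (Forced.triangle (H := H) hs hi hef hbc h₁ (hside hbc h₁ (hBas hab)) nac (hBas hab) hab).1 rfl
  have hBDB : ∀ {y a b c}, Forced H e f y a → D a b → Forced H e f b c → Forced H e f a c := by
    intro y a b c hya hab hbc
    by_contra nac
    have h₁ := hD.edge hab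
    have nba : ¬ Forced H e f b a := fun h => hBD' h hab
    exact (Forced.triangle (H := H) hs hi hef hbc h₁ (hside hbc h₁ nba) nac nba hya).2 rfl
  have hE : ForcingClosed H fun a b => D a b ∨ Forced H e f a b := by
    constructor
    · rintro a b x (h | h) h₁ h₂
      · exact .inl (hD.right h h₁ h₂)
      · exact .inr (h.right h₁ h₂)
    · rintro a b x (h | h) h₁ h₂
      · exact .inl (hD.left h h₁ h₂)
      · exact .inr (h.left h₁ h₂)
  -- Normal form of paths: two forced pairs merge, even with a `D`-step between them, so at most one
  -- forced pair survives, possibly with one `D`-step on either side.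
  have hform : ∀ {x y}, Relation.TransGen (fun a b => D a b ∨ Forced H e f a b) x y →
      D x y ∨ ∃ x' y', (x = x' ∨ D x x') ∧ Forced H e f x' y' ∧ (y' = y ∨ D y' y) := by
    intro x y h
    induction h with
    | single h =>
      rcases h with h | h
      · exact .inl h
      · exact .inr ⟨_, _, .inl rfl, h, .inl rfl⟩
    | @tail y z _ hyz ih =>
      rcases ih with ih | ⟨x', y', h₁, h₂, h₃⟩
      · rcases hyz with h | h
        · exact .inl (hD.trans ih h)
        · exact .inr ⟨_, _, .inr ih, h, .inl rfl⟩
      · rcases hyz with h | h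
        · refine .inr ⟨_, _, h₁, h₂, .inr ?_⟩
          rcases h₃ with rfl | h₃
          · exact h
          · exact hD.trans h₃ h
        · refine .inr ⟨x', z, h₁, ?_, .inl rfl⟩
          rcases h₃ with rfl | h₃
          · exact hBtr h₂ h
          · exact hBtr h₂ (hBDB h₂ h₃ h)
  have hirr : ∀ x, ¬ Relation.TransGen (fun a b => D a b ∨ Forced H e f a b) x x := by
    intro x h
    rcases hform h with h | ⟨x', y', h₁, h₂, h₃⟩
    · exact hD.irrefl _ h
    -- Rotating the closed path joins the `D`-steps at its two ends into at most one.
    · have : y' = x' ∨ D y' x' := by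
        rcases h₁ with rfl | h₁
        · exact h₃
        · rcases h₃ with rfl | h₃
          · exact .inr h₁
          · exact .inr (hD.trans h₃ h₁)
      rcases this with rfl | h
      · exact hBas h₂ h₂
      · exact hBD' h₂ h
  have hedge : ∀ {a b}, Relation.TransGen (fun a b => D a b ∨ Forced H e f a b) a b → H a b := by
    intro a b h
    induction h with
    | single h => exact h.elim hD.edge fun h => h.edge hef
    | @tail b c hab hbc ih =>
      by_contra h
      -- If `a c` were not an edge, the last pair `(b, c)` would force `(b, a)` and close a cycle.
      exact hirr a (hab.tail (hE.right hbc (hs ih) fun h' => h (hs h')))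
  refine ⟨Relation.TransGen fun a b => D a b ∨ Forced H e f a b,
    ⟨⟨?_, ?_⟩, hedge, Relation.TransGen.trans, hirr⟩, fun a b h => .single (.inl h),
    .single (.inr .base)⟩
  · intro a b x h
    induction h generalizing x with
    | single h => exact fun h₁ h₂ => .single (hE.right h h₁ h₂)
    | @tail b c hab hbc ih =>
      intro h₁ h₂
      by_cases h : H b x
      · exact hab.tail (hE.right hbc h h₂)
      · exact ih h₁ h
  · intro a b x h
    induction h using Relation.TransGen.head_induction_on generalizing x with
    | single h => exact fun h₁ h₂ => .single (hE.left h h₁ h₂)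
    | @head a c hac hcb ih =>
      intro h₁ h₂
      by_cases h : H x c
      · exact Relation.TransGen.head (hE.left hac h h₂) hcb
      · exact ih h₁ h

end Orientation

/-! ## Interval representations -/

section Representation

variable {V : Type*} {G : SimpleGraph V}

/-- The interval `[a u, b u]` of natural numbers is assigned to the vertex `u`, and `G` is the
intersection graph of these intervals. -/
structure IsRepresentation (G : SimpleGraph V) (a b : V → ℕ) : Prop where
  le : ∀ u, a u ≤ b u
  adj_iff : ∀ {u v}, u ≠ v → (G.Adj u v ↔ a u ≤ b v ∧ a v ≤ b u)

/-- The larger of `x` and `y'` lies in both sets by convexity. Contrapositively, for disjoint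
intervals one pair of points decides the order of all pairs. -/
theorem nonempty_inter_of_not_before {I J : Set ℝ} (hI : I.OrdConnected)
    (hJ : J.OrdConnected) {x y x' y' : ℝ} (hx : x ∈ I) (hy : y ∈ J) (hx' : x' ∈ I) (hy' : y' ∈ J)
    (h : x ≤ y) (h' : y' ≤ x') : (I ∩ J).Nonempty := by
  rcases le_total y' x with h₁ | h₁
  · exact ⟨x, hx, hJ.out hy' hy ⟨h₁, h⟩⟩
  · exact ⟨y', hI.out hx hx' ⟨h₁, h'⟩, hy'⟩

/-- An interval representation orients the complement transitively. -/
theorem IsIntervalGraph.exists_orientation (h : IsIntervalGraph G) :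
    ∃ R, PartialOrientation Gᶜ.Adj R ∧ ∀ {u v}, Gᶜ.Adj u v → R u v ∨ R v u := by
  obtain ⟨I, hI, hG⟩ := h
  have hd : ∀ {u v}, Gᶜ.Adj u v → ¬ (I u ∩ I v).Nonempty := by
    intro u v huv
    rw [SimpleGraph.compl_adj] at huv
    rw [← hG u v huv.1]
    exact huv.2
  have htot : ∀ {u v}, Gᶜ.Adj u v →
      (∀ x ∈ I u, ∀ y ∈ I v, x < y) ∨ ∀ x ∈ I v, ∀ y ∈ I u, x < y := by
    intro u v huv
    by_contra! h
    obtain ⟨⟨x, hx, y, hy, hyx⟩, x', hx', y', hy', h'⟩ := h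
    exact hd huv (nonempty_inter_of_not_before (hI u).1 (hI v).1 hy' hx' hx hy h' hyx)
  refine ⟨fun u v => ∀ x ∈ I u, ∀ y ∈ I v, x < y, ⟨⟨?_, ?_⟩, ?_, ?_, ?_⟩, htot⟩
  · intro u v x huv hux hvx
    refine (htot hux).resolve_right fun h => hvx ?_
    rw [SimpleGraph.compl_adj]
    obtain ⟨p, hp⟩ := (hI u).2
    have hlt : ∀ y ∈ I x, ∀ z ∈ I v, y < z := fun y hy z hz =>
      (h y hy p hp).trans (huv p hp z hz)
    have hne : v ≠ x := by
      rintro rfl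
      obtain ⟨q, hq⟩ := (hI v).2
      exact lt_irrefl _ (hlt q hq q hq)
    refine ⟨hne, fun hadj => ?_⟩
    obtain ⟨q, hq, hq'⟩ := (hG _ _ hne).1 hadj
    exact lt_irrefl _ (hlt q hq' q hq)
  · intro u v x huv hxv hxu
    refine (htot hxv).resolve_right fun h => hxu ?_
    rw [SimpleGraph.compl_adj]
    obtain ⟨p, hp⟩ := (hI v).2
    have hlt : ∀ y ∈ I u, ∀ z ∈ I x, y < z := fun y hy z hz =>
      (huv y hy p hp).trans (h p hp z hz)
    have hne : x ≠ u := by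
      rintro rfl
      obtain ⟨q, hq⟩ := (hI x).2
      exact lt_irrefl _ (hlt q hq q hq)
    refine ⟨hne, fun hadj => ?_⟩
    obtain ⟨q, hq, hq'⟩ := (hG _ _ hne).1 hadj
    exact lt_irrefl _ (hlt q hq' q hq)
  · intro u v huv
    rw [SimpleGraph.compl_adj]
    have hne : u ≠ v := by
      rintro rfl
      obtain ⟨q, hq⟩ := (hI u).2
      exact lt_irrefl _ (huv q hq q hq)
    refine ⟨hne, fun hadj => ?_⟩
    obtain ⟨q, hq, hq'⟩ := (hG _ _ hne).1 hadj
    exact lt_irrefl _ (huv q hq q hq')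
  · intro u v x huv hvx p hp q hq
    obtain ⟨r, hr⟩ := (hI v).2
    exact (huv p hp r hr).trans (hvx r hr q hq)
  · intro u h
    obtain ⟨q, hq⟩ := (hI u).2
    exact lt_irrefl _ (h q hq q hq)

/-- Interval graphs have no induced cycle of length four. -/
theorem IsIntervalGraph.no_square (h : IsIntervalGraph G) {u v x y : V} (huv : Gᶜ.Adj u v)
    (hxy : Gᶜ.Adj x y) (hux : G.Adj u x) (huy : G.Adj u y) (hvx : G.Adj v x) (hvy : G.Adj v y) :
    False := by
  obtain ⟨I, hI, hG⟩ := h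
  rw [SimpleGraph.compl_adj, hG _ _ (Gᶜ.ne_of_adj ‹_›)] at huv hxy
  rw [hG _ _ (G.ne_of_adj ‹_›)] at hux huy hvx hvy
  obtain ⟨p, hp, hp'⟩ := hux
  obtain ⟨q, hq, hq'⟩ := huy
  obtain ⟨r, hr, hr'⟩ := hvx
  obtain ⟨s, hs, hs'⟩ := hvy
  -- The disjoint pairs `u, v` and `x, y` are each strictly ordered. The four common points
  -- translate the two orders into contradictory inequalities.
  have key : ∀ {I J : Set ℝ} {x y x' y' : ℝ}, I.OrdConnected → J.OrdConnected →
      ¬ (I ∩ J).Nonempty → x ∈ I → y ∈ J → x' ∈ I → y' ∈ J → x ≤ y → x' < y' := by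
    intro I J x y x' y' hI hJ h hx hy hx' hy' hle
    by_contra! h'
    exact h (nonempty_inter_of_not_before hI hJ hx hy hx' hy' hle h')
  have hvu : ¬ (I v ∩ I u).Nonempty := by rw [Set.inter_comm]; exact huv.2
  have hyx : ¬ (I y ∩ I x).Nonempty := by rw [Set.inter_comm]; exact hxy.2
  rcases le_total p r with h | h
  · have h₁ := key (hI u).1 (hI v).1 huv.2 hp hr hq hr h
    have h₂ := key (hI u).1 (hI v).1 huv.2 hp hr hp hs h
    rcases le_total p q with h₃ | h₃
    · have := key (hI x).1 (hI y).1 hxy.2 hp' hq' hr' hq' h₃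
      linarith
    · have := key (hI y).1 (hI x).1 hyx hq' hp' hs' hp' h₃
      linarith
  · have h₁ := key (hI v).1 (hI u).1 hvu hr hp hs hp h
    have h₂ := key (hI v).1 (hI u).1 hvu hr hp hr hq h
    rcases le_total p q with h₃ | h₃
    · have := key (hI x).1 (hI y).1 hxy.2 hp' hq' hp' hs' h₃
      linarith
    · have := key (hI y).1 (hI x).1 hyx hq' hp' hq' hr' h₃
      linarith

variable {D : V → V → Prop}

/-- A transitive orientation of the complement of an interval graph has nested sets of
successors. -/
theorem IsIntervalGraph.nested (h : IsIntervalGraph G) (hD : PartialOrientation Gᶜ.Adj D)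
    (hDt : ∀ {u v}, Gᶜ.Adj u v → D u v ∨ D v u) {u v x y : V} (huv : D u v) (hxy : D x y)
    (huy : ¬ D u y) : D x v := by
  by_contra hxv
  -- Otherwise transitivity excludes every orientation between `{u, v}` and `{x, y}`, and the four
  -- vertices induce a cycle of length four.
  have hadj : ∀ {p q}, p ≠ q → ¬ D p q → ¬ D q p → G.Adj p q := by
    intro p q hpq h₁ h₂
    by_contra h
    rcases hDt ((G.compl_adj p q).2 ⟨hpq, h⟩) with h | h <;> contradiction
  have e₁ : G.Adj u x := hadj (by rintro rfl; contradiction) (fun h => huy (hD.trans h hxy))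
    (fun h => hxv (hD.trans h huv))
  have e₂ : G.Adj u y := hadj (by rintro rfl; exact hxv (hD.trans hxy huv)) huy
    (fun h => hxv (hD.trans hxy (hD.trans h huv)))
  have e₃ : G.Adj v x := hadj (by rintro rfl; exact huy (hD.trans huv hxy))
    (fun h => huy (hD.trans huv (hD.trans h hxy))) hxv
  have e₄ : G.Adj v y := hadj (by rintro rfl; exact huy huv) (fun h => huy (hD.trans huv h))
    (fun h => hxv (hD.trans hxy h))
  exact h.no_square (hD.edge huv) (hD.edge hxy) e₁ e₂ e₃ e₄

open Classical Finset in
/-- A transitive orientation of the complement of an interval graph yields a representation: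
the right end points are given by the numbers of successors. -/
theorem IsIntervalGraph.isRepresentation [Fintype V] (h : IsIntervalGraph G)
    (hD : PartialOrientation Gᶜ.Adj D) (hDt : ∀ {u v}, Gᶜ.Adj u v → D u v ∨ D v u)
    {a b : V → ℕ} (hb : ∀ u, b u = Fintype.card V - (#{v | D u v} + 1))
    (hau : ∀ u, a u ≤ b u) (hav : ∀ u v, G.Adj u v → a u ≤ b v)
    (ha : ∀ u, a u = b u ∨ ∃ v, G.Adj u v ∧ a u = b v) : IsRepresentation G a b := by
  have hcard : ∀ u, #{v | D u v} < Fintype.card V := by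
    intro u
    refine Finset.card_lt_univ_of_notMem (x := u) ?_
    simpa using hD.irrefl u
  have hlt : ∀ {u v}, D u v → b u < a v := by
    intro u v huv
    -- If `x` does not precede `v`, the successors of `x` form a proper subset of those of `u`, with
    -- `v` missing. The end point `a v` is the right end of `v` or of a neighbour of `v`, and
    -- neither of these precedes `v`.
    have hx : ∀ x, ¬ D x v → b u < b x := by
      intro x hxv
      have : #{z | D x z} < #{z | D u z} := by
        refine Finset.card_lt_card (Finset.ssubset_iff_of_subset ?_ |>.2 ⟨v, ?_, ?_⟩)
        · intro z hz
          simp only [Finset.mem_filter, Finset.mem_univ, true_and] at hz ⊢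
          by_contra hn
          exact hxv (h.nested hD hDt huv hz hn)
        · simpa using huv
        · simpa using hxv
      have := hcard u
      rw [hb, hb]
      omega
    rcases ha v with e | ⟨x, hvx, e⟩
    · rw [e]; exact hx v (hD.irrefl v)
    · rw [e]
      refine hx x fun hxv => ?_
      exact ((G.compl_adj _ _).1 (hD.edge hxv)).2 hvx.symm
  refine ⟨hau, fun {u v} huv => ⟨fun h => ⟨hav u v h, hav v u h.symm⟩, fun h' => ?_⟩⟩
  by_contra hn
  rcases hDt ((G.compl_adj u v).2 ⟨huv, hn⟩) with h₁ | h₁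
  · exact absurd (hlt h₁) (by omega)
  · exact absurd (hlt h₁) (by omega)

end Representation

/-! ## Cuts -/

section Cuts

variable {V : Type*} {G : SimpleGraph V} {a b w : V → ℕ} {l : ℕ}

/-- Two remaining intervals between `s` and `t` are linked if no cut strictly between `s` and `t`
is free of remaining intervals. -/
theorem reachable_of_no_cut (hG : IsRepresentation G a b) {X : Finset V} {s t : ℕ}
    (hs : ∀ u, a u < s → s ≤ b u → u ∈ X) (ht : ∀ u, a u < t → t ≤ b u → u ∈ X)
    (hp : ∀ p, s < p → p < t → ∃ z, z ∉ X ∧ a z < p ∧ p ≤ b z) :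
    ∀ d, ∀ u v : {v | v ∉ X}, t - b u ≤ d → s ≤ a u → b u < t → b v < t → b u ≤ b v →
      (G.induce {v | v ∉ X}).Reachable u v := by
  have hadj : ∀ u v : {v | v ∉ X}, a u ≤ b v → a v ≤ b u →
      (G.induce {v | v ∉ X}).Reachable u v := by
    intro u v h₁ h₂
    by_cases huv : u = v
    · rw [huv]
    · refine SimpleGraph.Adj.reachable ?_
      exact (hG.adj_iff fun h => huv (Subtype.ext h)).2 ⟨h₁, h₂⟩
  intro d
  induction d with
  | zero => intro u v h₁ _ h₂; omega
  | succ d ih =>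
    intro u v hd hsu hut hvt huv
    have hau := hG.le u
    by_cases h : a v ≤ b u
    · exact hadj u v (hau.trans huv) h
    · push Not at h
      have hav := hG.le v
      -- An interval through the cut just after the right end of `u` meets `u` and ends later. It
      -- cannot pass `s` or `t`, since all intervals through these are deleted.
      obtain ⟨z, hzX, hz₁, hz₂⟩ := hp (b u + 1) (by omega) (by omega)
      have hzs : s ≤ a z := by
        by_contra! h'
        exact hzX (hs z h' (by omega))
      have hzt : b z < t := by
        by_contra! h'
        exact hzX (ht z (by omega) h')
      have huz := hadj u ⟨z, hzX⟩ (by simp only; omega) (by simp only; omega)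
      refine huz.trans ?_
      by_cases h' : b z ≤ b v
      · exact ih ⟨z, hzX⟩ v (by simp only; omega) hzs hzt hvt h'
      · exact hadj _ _ (by simp only; omega) (by simp only; omega)

variable [Fintype V]

/-- The vertices whose intervals lie between the cuts `s` and `t`. -/
def region (a b : V → ℕ) (s t : ℕ) : Finset V := {u | s ≤ a u ∧ b u < t}

/-- The vertices whose intervals begin after the cut `s` and contain the cut `t`. -/
def crossing (a b : V → ℕ) (s t : ℕ) : Finset V := {u | s ≤ a u ∧ a u < t ∧ t ≤ b u}

@[simp] theorem mem_region {s t : ℕ} {u : V} : u ∈ region a b s t ↔ s ≤ a u ∧ b u < t := by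
  simp [region]

@[simp] theorem mem_crossing {s t : ℕ} {u : V} :
    u ∈ crossing a b s t ↔ s ≤ a u ∧ a u < t ∧ t ≤ b u := by
  simp [crossing]

variable [DecidableEq V]

/-- The deletion of `X` leaves a part of weight at most `l` between any two consecutive ones of
a sequence of cuts from `0` to the given one, and `X` contains all intervals through these
cuts. -/
inductive Cut (a b w : V → ℕ) (l : ℕ) (X : Finset V) : ℕ → Prop
  | zero : Cut a b w l X 0
  | step {s t : ℕ} : Cut a b w l X s → s < t → (∀ u, a u < t → t ≤ b u → u ∈ X) →
      ∑ u ∈ region a b s t \ X, w u ≤ l → Cut a b w l X t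

theorem Cut.mem {X : Finset V} {t : ℕ} (h : Cut a b w l X t) {u : V} (h₁ : a u < t)
    (h₂ : t ≤ b u) : u ∈ X := by
  cases h with
  | zero => omega
  | step _ _ h _ => exact h u h₁ h₂

/-- Every interval inspected by a sequence of cuts up to `t` begins before `t`, so the rest of the
deleted set can be chosen afterwards. -/
theorem Cut.congr (hab : ∀ u, a u ≤ b u) {X X' : Finset V} {t : ℕ} (h : Cut a b w l X t)
    (hX : ∀ u, a u < t → (u ∈ X ↔ u ∈ X')) : Cut a b w l X' t := by
  induction h with
  | zero => exact .zero
  | @step s t _ hst hm hw ih =>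
    refine .step (ih fun u hu => hX u (hu.trans hst)) hst
      (fun u h₁ h₂ => (hX u h₁).1 (hm u h₁ h₂)) (le_trans (le_of_eq ?_) hw)
    congr 1
    ext u
    simp only [Finset.mem_sdiff, mem_region, and_congr_right_iff, and_imp]
    intro _ h₂
    rw [hX u ((hab u).trans_lt h₂)]

open Classical in
-- A path of remaining vertices cannot pass a cut. A component having a vertex that ends before `s`
-- is handled by induction. Any other component lies in the region between `s` and `t`.
theorem Cut.component_le (hG : IsRepresentation G a b) {X : Finset V} {t : ℕ}
    (h : Cut a b w l X t) (v : {v | v ∉ X}) (hv : b v < t) :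
    (∀ u, (G.induce {v | v ∉ X}).Reachable v u → b u < t) ∧
    ∑ u with (G.induce {v | v ∉ X}).Reachable v u, w u.1 ≤ l := by
  induction h generalizing v with
  | zero => omega
  | @step s t hs hst hm hw ih =>
    by_cases hex : ∃ u, (G.induce {v | v ∉ X}).Reachable v u ∧ b u < s
    · obtain ⟨u, hvu, hu⟩ := hex
      obtain ⟨h₁, h₂⟩ := ih u hu
      refine ⟨fun x hx => (h₁ x (hvu.symm.trans hx)).trans hst, le_of_eq_of_le ?_ h₂⟩
      congr 1
      ext x
      simp only [Finset.mem_filter, Finset.mem_univ, true_and]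
      exact ⟨fun h => hvu.symm.trans h, fun h => hvu.trans h⟩
    · push Not at hex
      have has : ∀ u, (G.induce {v | v ∉ X}).Reachable v u → s ≤ a u := by
        intro u hu
        by_contra! h
        exact u.2 (hs.mem h (hex u hu))
      have hbt : ∀ u, (G.induce {v | v ∉ X}).Reachable v u → b u < t := by
        intro u hu
        rw [SimpleGraph.reachable_iff_reflTransGen] at hu
        induction hu with
        | refl => exact hv
        | @tail x y _ hxy ih =>
          by_contra! h
          have h₁ : G.Adj x y := hxy
          have := (hG.adj_iff (G.ne_of_adj h₁)).1 h₁
          exact y.2 (hm y (by omega) h)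
      refine ⟨hbt, le_trans ?_ hw⟩
      refine le_of_eq_of_le (Finset.sum_map _ (Function.Embedding.subtype _) w).symm ?_
      refine Finset.sum_le_sum_of_subset ?_
      intro u hu
      simp only [Finset.mem_map, Finset.mem_filter, Finset.mem_univ, true_and] at hu
      obtain ⟨x, hx, rfl⟩ := hu
      simp only [Finset.mem_sdiff, mem_region]
      exact ⟨⟨has x hx, hbt x hx⟩, x.2⟩

open Classical in
-- With the last usable cut `s` before `t`, there is no usable cut between the two. All that remains
-- of the region is then linked, so it lies in one component and weighs at most `l`.
theorem cut_of_component_le (hG : IsRepresentation G a b) {X : Finset V}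
    (hX : ∀ v, ∑ u with (G.induce {v | v ∉ X}).Reachable v u, w u.1 ≤ l) (t : ℕ)
    (ht : ∀ u, a u < t → t ≤ b u → u ∈ X) : Cut a b w l X t := by
  induction t using Nat.strong_induction_on with
  | _ t ih =>
    rcases Nat.eq_zero_or_pos t with rfl | hpos
    · exact .zero
    have hex : ∃ s, s < t ∧ (∀ u, a u < s → s ≤ b u → u ∈ X) ∧
        ∀ p, s < p → p < t → ¬ ∀ u, a u < p → p ≤ b u → u ∈ X := by
      -- The cut `0` is always usable: no interval begins before it.
      have h0 : (fun p => ∀ u, a u < p → p ≤ b u → u ∈ X) 0 := fun u h => by omega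
      refine ⟨Nat.findGreatest (fun p => ∀ u, a u < p → p ≤ b u → u ∈ X) (t - 1),
        ?_, Nat.findGreatest_spec (P := fun p => ∀ u, a u < p → p ≤ b u → u ∈ X)
          (Nat.zero_le _) h0, fun p h₁ h₂ => Nat.findGreatest_is_greatest h₁ (by omega)⟩
      have := Nat.findGreatest_le (P := fun p => ∀ u, a u < p → p ≤ b u → u ∈ X) (t - 1)
      omega
    obtain ⟨s, hst, hs, hp⟩ := hex
    refine .step (ih s hst hs) hst ht ?_
    rcases (region a b s t \ X).eq_empty_or_nonempty with he | ⟨v, hv⟩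
    · simp [he]
    rw [Finset.mem_sdiff, mem_region] at hv
    refine le_trans ?_ (hX ⟨v, hv.2⟩)
    refine le_of_le_of_eq ?_ (Finset.sum_map _ (Function.Embedding.subtype _) w)
    refine Finset.sum_le_sum_of_subset fun u hu => ?_
    rw [Finset.mem_sdiff, mem_region] at hu
    simp only [Finset.mem_map, Finset.mem_filter, Finset.mem_univ, true_and]
    refine ⟨⟨u, hu.2⟩, ?_, rfl⟩
    have hp' : ∀ p, s < p → p < t → ∃ z, z ∉ X ∧ a z < p ∧ p ≤ b z := by
      intro p h₁ h₂
      have := hp p h₁ h₂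
      push Not at this
      obtain ⟨z, h₁, h₂, h₃⟩ := this
      exact ⟨z, h₃, h₁, h₂⟩
    rcases le_total (b u) (b v) with h | h
    · exact (reachable_of_no_cut hG hs ht hp' _ ⟨u, hu.2⟩ ⟨v, hv.2⟩ le_rfl hu.1.1 hu.1.2
        hv.1.2 h).symm
    · exact reachable_of_no_cut hG hs ht hp' _ ⟨v, hv.2⟩ ⟨u, hu.2⟩ le_rfl hv.1.1 hv.1.2
        hu.1.2 h

/-- No interval reaches `n`, so the final cut demands no deletions and every remaining vertex lies
before it. -/
theorem isYesInstance_iff (hG : IsRepresentation G a b) {n k : ℕ} (hb : ∀ u, b u < n) :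
    IsYesInstance G w k l ↔ ∃ X : Finset V, ∑ v ∈ X, w v ≤ k ∧ Cut a b w l X n := by
  classical
  refine exists_congr fun X => and_congr_right fun _ => ?_
  simp only [heaviestComponent, Finset.sup_le_iff, Finset.mem_univ, true_imp_iff]
  have key : (∀ C : (G.induce {v | v ∉ X}).ConnectedComponent,
      ∑ v with (G.induce {v | v ∉ X}).connectedComponentMk v = C, w v.1 ≤ l) ↔
      ∀ v, ∑ u with (G.induce {v | v ∉ X}).Reachable v u, w u.1 ≤ l := by
    constructor
    · intro h v
      refine le_of_eq_of_le ?_ (h ((G.induce {v | v ∉ X}).connectedComponentMk v))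
      congr 1
      ext u
      simp only [Finset.mem_filter, Finset.mem_univ, true_and, SimpleGraph.ConnectedComponent.eq]
      exact ⟨fun h => h.symm, fun h => h.symm⟩
    · intro h C
      induction C using SimpleGraph.ConnectedComponent.ind with
      | h v =>
        refine le_of_eq_of_le ?_ (h v)
        congr 1
        ext u
        simp only [Finset.mem_filter, Finset.mem_univ, true_and,
          SimpleGraph.ConnectedComponent.eq]
        exact ⟨fun h => h.symm, fun h => h.symm⟩
  constructor
  · intro h
    refine cut_of_component_le hG (key.1 fun C => ?_) n fun u _ h => absurd (hb u) (by omega)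
    convert h C
  · intro h C
    convert key.2 (fun v => (h.component_le hG v (hb v)).2) C

/-! ## The recurrence -/

/-- Some set of weight at most `c` admits a sequence of cuts up to `t`. -/
def Achievable (a b w : V → ℕ) (l t c : ℕ) : Prop :=
  ∃ X : Finset V, Cut a b w l X t ∧ ∑ u ∈ X with a u < t, w u ≤ c

theorem achievable_zero (c : ℕ) : Achievable a b w l 0 c := ⟨∅, .zero, by simp⟩

theorem achievable_iff_isYesInstance (hG : IsRepresentation G a b) {n k : ℕ}
    (hb : ∀ u, b u < n) : Achievable a b w l n k ↔ IsYesInstance G w k l := by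
  rw [isYesInstance_iff hG hb]
  refine exists_congr fun X => ?_
  rw [and_comm, Finset.filter_true_of_mem fun u _ => (hG.le u).trans_lt (hb u)]

/-- The chosen vertices that begin before `t` split into those beginning before `s`, those crossing
`t` only, and those inside the region. Vertices through `s` are already paid for in `c'`, hence the
condition `s ≤ a u` in `crossing`. -/
theorem achievable_iff (hab : ∀ u, a u ≤ b u) {t c : ℕ} (ht : 0 < t) :
    Achievable a b w l t c ↔ ∃ s < t, ∃ c', Achievable a b w l s c' ∧ ∃ Y ⊆ region a b s t,
      ∑ u ∈ region a b s t \ Y, w u ≤ l ∧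
      c' + ∑ u ∈ crossing a b s t, w u + ∑ u ∈ Y, w u ≤ c := by
  constructor
  · rintro ⟨X, hX, hc⟩
    cases hX with
    | zero => omega
    | @step s _ hs hst hm hw =>
      refine ⟨s, hst, _, ⟨X, hs, le_rfl⟩, region a b s t ∩ X, Finset.inter_subset_left, ?_, ?_⟩
      · rwa [Finset.sdiff_inter_self_left]
      · refine le_trans (le_of_eq ?_) hc
        have hd₁ : Disjoint (X.filter fun u => a u < s) (crossing a b s t) := by
          rw [Finset.disjoint_left]
          intro u h₁ h₂
          simp only [Finset.mem_filter, mem_crossing] at h₁ h₂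
          omega
        rw [← Finset.sum_union hd₁, ← Finset.sum_union]
        · congr 1
          ext u
          have := hab u
          have := hm u
          simp only [Finset.mem_union, Finset.mem_filter, mem_crossing, Finset.mem_inter,
            mem_region]
          by_cases hu : u ∈ X
          · simp only [hu, true_and, and_true]; omega
          · simp only [hu, false_and, and_false, false_or, or_false, iff_false]
            tauto
        · rw [Finset.disjoint_left]
          intro u h₁ h₂
          have := hab u
          simp only [Finset.mem_union, Finset.mem_filter, mem_crossing, Finset.mem_inter,
            mem_region] at h₁ h₂
          omega
  · rintro ⟨s, hst, c', ⟨X, hX, hc'⟩, Y, hY, hw, hc⟩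
    have hYr : ∀ u ∈ Y, s ≤ a u ∧ b u < t := fun u hu => mem_region.1 (hY hu)
    refine ⟨(X.filter fun u => a u < s) ∪ crossing a b s t ∪ Y, .step (hX.congr hab ?_) hst ?_ ?_,
      ?_⟩
    · intro u hu
      have : u ∉ Y := fun h => by have := hYr u h; omega
      simp only [Finset.mem_union, Finset.mem_filter, mem_crossing, hu, this]
      simp only [and_true, or_false]
      constructor
      · exact .inl
      · rintro (h | h)
        · exact h
        · omega
    · intro u h₁ h₂
      simp only [Finset.mem_union, Finset.mem_filter, mem_crossing]
      by_cases h : a u < s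
      · exact .inl (.inl ⟨hX.mem h (by omega), h⟩)
      · exact .inl (.inr ⟨by omega, h₁, h₂⟩)
    · refine le_trans (Finset.sum_le_sum_of_subset ?_) hw
      intro u hu
      simp only [Finset.mem_sdiff, Finset.mem_union, not_or] at hu ⊢
      exact ⟨hu.1, hu.2.2⟩
    · refine le_trans ?_ hc
      refine le_trans (Finset.sum_le_sum_of_subset (Finset.filter_subset _ _)) ?_
      have h₁ := Finset.sum_union_inter (f := w)
        (s₁ := (X.filter fun u => a u < s) ∪ crossing a b s t) (s₂ := Y)
      have h₂ := Finset.sum_union_inter (f := w)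
        (s₁ := X.filter fun u => a u < s) (s₂ := crossing a b s t)
      omega

/-- The weight `y` of a subset of the region between `s` and `t` is the weight of the kept vertices
(if `l ≤ k`) or of the deleted vertices (if `k < l`). It is at most `min k l`, and in the second
case the kept vertices weigh at most `l`. -/
theorem achievable_iff_of_le (hab : ∀ u, a u ≤ b u) {t c k : ℕ} (ht : 0 < t) (hck : c ≤ k)
    {d : ℕ → ℕ} (hd : ∀ s < t, ∀ c ≤ k, d s ≤ c ↔ Achievable a b w l s c) :
    Achievable a b w l t c ↔ ∃ s < t, ∃ y < min k l + 1,
      (∃ Y ⊆ region a b s t, ∑ u ∈ Y, w u = y) ∧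
      (l ≤ k ∨ ∑ u ∈ region a b s t, w u - y ≤ l) ∧
      d s + ∑ u ∈ crossing a b s t, w u +
        (if l ≤ k then ∑ u ∈ region a b s t, w u - y else y) ≤ c := by
  rw [achievable_iff hab ht]
  refine exists_congr fun s => and_congr_right fun hst => ?_
  have hsum : ∀ Y ⊆ region a b s t, ∑ u ∈ region a b s t \ Y, w u + ∑ u ∈ Y, w u =
      ∑ u ∈ region a b s t, w u := fun Y hY => Finset.sum_sdiff hY
  constructor
  · rintro ⟨c', hc', Y, hY, hw, hc⟩
    have h₁ := (hd s hst c' (by omega)).2 hc'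
    have h₂ := hsum Y hY
    by_cases hlk : l ≤ k
    · refine ⟨_, ?_, ⟨region a b s t \ Y, Finset.sdiff_subset, rfl⟩, .inl hlk, ?_⟩
      · omega
      · rw [if_pos hlk]; omega
    · refine ⟨_, ?_, ⟨Y, hY, rfl⟩, .inr ?_, ?_⟩
      · omega
      · omega
      · rw [if_neg hlk]; omega
  · rintro ⟨_, hy, ⟨Y, hY, rfl⟩, hl, hc⟩
    have h₂ := hsum Y hY
    -- The table is only known to be right for budgets up to `k`; here `d s ≤ c ≤ k`.
    have h₃ : Achievable a b w l s (d s) := (hd s hst _ (by omega)).1 le_rfl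
    by_cases hlk : l ≤ k
    · rw [if_pos hlk] at hc
      refine ⟨_, h₃, region a b s t \ Y, Finset.sdiff_subset, ?_, ?_⟩
      · rw [Finset.sdiff_sdiff_eq_self hY]; omega
      · omega
    · rw [if_neg hlk] at hc
      exact ⟨_, h₃, Y, hY, by omega, by omega⟩

end Cuts

/-! ## The program

Registers: `0, 1, 2` hold `n, k, l`; `3` holds `n ^ 2`, `4` holds `2 * n ^ 2`, `5` holds
`min k l + 1`. Pairs `(u, v)` of vertices are encoded as `u * n + v`.
Arrays: `0` weights, `1` adjacency, `2` multiples of `n`, `3` and `4` first and second component of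
a pair, `5` non-adjacency, `6` orientation, `7` queue of oriented pairs, `8` right end points,
`9` left end points, `10` weights of subsets, `11` the table of the dynamic program. -/

namespace Prog

/-- Computes register `5`. -/
def capacity : Prog :=
  .ite (.sub (.reg 1) (.reg 2)) (.assign 5 (.add (.reg 2) (.lit 1)))
    (.assign 5 (.add (.reg 1) (.lit 1)))

/-- Computes register `3` and array `2`. -/
def multiples : Prog :=
  .loop 10 0 (.seq (.store 2 (.reg 10) (.reg 3)) (.assign 3 (.add (.reg 3) (.reg 0))))

/-- Computes registers `3`, `4`, `5` and array `2`. -/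
def prepare : Prog := .seq capacity <| .seq multiples (.assign 4 (.add (.reg 3) (.reg 3)))

/-- The entries of the tables `3`, `4`, `5` for the pair in registers `10` and `11`. -/
def tabulatePair : Prog :=
  .seq (.assign 12 (.add (.get 2 (.reg 10)) (.reg 11))) <|
  .seq (.store 3 (.reg 12) (.reg 10)) <|
  .seq (.store 4 (.reg 12) (.reg 11)) <|
  .ite (.add (.sub (.reg 10) (.reg 11)) (.sub (.reg 11) (.reg 10)))
    (.store 5 (.reg 12) (.sub (.lit 1) (.get 1 (.reg 12)))) (.store 5 (.reg 12) (.lit 0))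

/-- Computes arrays `3`, `4`, `5`. -/
def tabulate : Prog := .loop 10 0 (.loop 11 0 tabulatePair)

/-- Orients the pair encoded in register `20` if it is not oriented yet. -/
def push : Prog :=
  .ite (.get 6 (.reg 20)) .skip <|
    .seq (.store 6 (.reg 20) (.lit 1)) <|
    .seq (.store 7 (.reg 14) (.reg 20)) (.assign 14 (.add (.reg 14) (.lit 1)))

/-- Orients the pair in register `20` if it is non-adjacent and the pair in register `21` is
adjacent, equal or oriented. -/
def pushForced : Prog :=
  .ite (.get 5 (.reg 20))
    (.ite (.add (.sub (.lit 1) (.get 5 (.reg 21))) (.get 6 (.reg 21))) push .skip) .skip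

/-- Orients the pairs forced by the pair in registers `17` and `18` and the vertex in register
`19`. -/
def propagateAt : Prog :=
  .seq (.assign 20 (.add (.get 2 (.reg 17)) (.reg 19))) <|
  .seq (.assign 21 (.add (.get 2 (.reg 18)) (.reg 19))) <|
  .seq pushForced <|
  .seq (.assign 20 (.add (.get 2 (.reg 19)) (.reg 18))) <|
  .seq (.assign 21 (.add (.get 2 (.reg 19)) (.reg 17))) pushForced

/-- Processes the next pair of the queue. -/
def processNext : Prog :=
  .seq (.assign 12 (.get 7 (.reg 13))) <|
  .seq (.assign 13 (.add (.reg 13) (.lit 1))) <|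
  .seq (.assign 17 (.get 3 (.reg 12))) <|
  .seq (.assign 18 (.get 4 (.reg 12))) <|
  .loop 19 0 propagateAt

/-- Orients the pair in register `15` if it is non-adjacent and not oriented. -/
def tryNext : Prog :=
  .seq (.assign 20 (.reg 15)) <|
  .seq (.assign 21 (.add (.get 2 (.get 4 (.reg 15))) (.get 3 (.reg 15)))) <|
  .seq (.assign 15 (.add (.reg 15) (.lit 1)))
  (.ite (.get 5 (.reg 20)) (.ite (.get 6 (.reg 21)) .skip push) .skip)

/-- Orients the complement transitively. -/
def orient : Prog :=
  .loop 16 4 (.ite (.sub (.reg 14) (.reg 13)) processNext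
    (.ite (.sub (.reg 3) (.reg 15)) tryNext .skip))

end Prog

/-! ### Tables -/

/-- The encoding of a pair of vertices. -/
def code {n : ℕ} (u v : Fin n) : ℕ := u.1 * n + v.1

theorem mul_add_inj {n u v u' v' : ℕ} (hv : v < n) (hv' : v' < n) :
    u * n + v = u' * n + v' ↔ u = u' ∧ v = v' := by
  refine ⟨fun h => ?_, fun h => by rw [h.1, h.2]⟩
  have h₁ : u = u' := by
    have := congrArg (· / n) h
    simpa [Nat.add_comm, Nat.add_mul_div_right _ _ (Nat.zero_lt_of_lt hv),
      Nat.div_eq_of_lt hv, Nat.div_eq_of_lt hv'] using this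
  subst h₁
  exact ⟨rfl, by omega⟩

theorem code_inj {n : ℕ} {u v u' v' : Fin n} : code u v = code u' v' ↔ u = u' ∧ v = v' := by
  rw [code, code, mul_add_inj v.2 v'.2, Fin.ext_iff, Fin.ext_iff]

theorem code_lt {n : ℕ} (u v : Fin n) : code u v < n * n := by
  have h₁ : (u.1 + 1) * n ≤ n * n := Nat.mul_le_mul_right n u.2
  have := v.2
  rw [Nat.succ_mul] at h₁
  unfold code
  omega

theorem exists_code {n c : ℕ} (h : c < n * n) : ∃ u v : Fin n, code u v = c := by
  have hn : 0 < n := Nat.pos_of_ne_zero fun h0 => by subst h0; simp at h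
  exact ⟨⟨c / n, Nat.div_lt_of_lt_mul h⟩, ⟨c % n, Nat.mod_lt _ hn⟩, Nat.div_add_mod' c n⟩

open Classical in
/-- The contents of the memory after tabulation. -/
structure Tables {n : ℕ} (G : SimpleGraph (Fin n)) (s : State) : Prop where
  size : s.reg 0 = n
  pairs : s.reg 3 = n * n
  rounds : s.reg 4 = n * n + n * n
  adj : ∀ u v, s.arr 1 (code u v) = if G.Adj u v then 1 else 0
  base : ∀ u : Fin n, s.arr 2 u = u * n
  fst : ∀ u v : Fin n, s.arr 3 (code u v) = u
  snd : ∀ u v : Fin n, s.arr 4 (code u v) = v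
  nonadj : ∀ u v, s.arr 5 (code u v) = if Gᶜ.Adj u v then 1 else 0

theorem Tables.of_eq {n : ℕ} {G : SimpleGraph (Fin n)} {s s' : State} (h : Tables G s)
    (h₀ : s'.reg 0 = s.reg 0) (h₃ : s'.reg 3 = s.reg 3) (h₄ : s'.reg 4 = s.reg 4)
    (h₁ : ∀ a, 1 ≤ a → a ≤ 5 → s'.arr a = s.arr a) : Tables G s' where
  size := h₀.trans h.size
  pairs := h₃.trans h.pairs
  rounds := h₄.trans h.rounds
  adj := by rw [h₁ 1 (by decide) (by decide)]; exact h.adj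
  base := by rw [h₁ 2 (by decide) (by decide)]; exact h.base
  fst := by rw [h₁ 3 (by decide) (by decide)]; exact h.fst
  snd := by rw [h₁ 4 (by decide) (by decide)]; exact h.snd
  nonadj := by rw [h₁ 5 (by decide) (by decide)]; exact h.nonadj

/-- A program leaves the tables unchanged. -/
def Prog.KeepsTables (p : Prog) : Bool :=
  !p.writesReg 0 && !p.writesReg 3 && !p.writesReg 4 && !p.writesArr 1 && !p.writesArr 2 &&
    !p.writesArr 3 && !p.writesArr 4 && !p.writesArr 5

theorem Tables.frame {n : ℕ} {G : SimpleGraph (Fin n)} {s s' : State} (h : Tables G s) {p : Prog}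
    (hF : p.Frame s s') (hp : p.KeepsTables = true) : Tables G s' := by
  simp only [Prog.KeepsTables, Bool.and_eq_true, Bool.not_eq_true'] at hp
  obtain ⟨⟨⟨⟨⟨⟨⟨p₀, p₃⟩, p₄⟩, q₁⟩, q₂⟩, q₃⟩, q₄⟩, q₅⟩ := hp
  refine h.of_eq (hF.reg _ p₀) (hF.reg _ p₃) (hF.reg _ p₄) fun a h₁ h₂ => ?_
  have : a = 1 ∨ a = 2 ∨ a = 3 ∨ a = 4 ∨ a = 5 := by omega
  rcases this with rfl | rfl | rfl | rfl | rfl <;> apply hF.arr <;> assumption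

theorem run_multiples {n : ℕ} {s : State} (hn : s.reg 0 = n) (h₃ : s.reg 3 = 0) :
    (Prog.multiples.run s).reg 3 = n * n ∧ ∀ u < n, (Prog.multiples.run s).arr 2 u = u * n := by
  have := Prog.run_loop (x := 10) (r := 0) (p := .seq (.store 2 (.reg 10) (.reg 3))
    (.assign 3 (.add (.reg 3) (.reg 0))))
    (fun i s' => s'.reg 3 = i * n ∧ ∀ u < i, s'.arr 2 u = u * n) s
    (by simp [h₃]) (by
      intro i hi s' hF hr ⟨h₁, h₂⟩
      have h0 : s'.reg 0 = n := (hF.reg 0 rfl).trans hn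
      refine ⟨by simp [Prog.run, h₁, h0, Nat.succ_mul], fun u hu => ?_⟩
      simp only [Prog.run, State.arr_setReg, State.arr_setArr_apply, Expr.eval, hr, h₁,
        true_and]
      split_ifs with h
      · rw [h]
      · exact h₂ u (by omega))
  rwa [hn] at this

theorem run_capacity (s : State) :
    (Prog.capacity.run s).reg 5 = min (s.reg 1) (s.reg 2) + 1 := by
  by_cases h : s.reg 1 - s.reg 2 = 0 <;> simp [Prog.capacity, Prog.run, h] <;> omega

theorem run_prepare {n : ℕ} {s : State} (hn : s.reg 0 = n) (h₃ : s.reg 3 = 0) :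
    (Prog.prepare.run s).reg 3 = n * n ∧ (Prog.prepare.run s).reg 4 = n * n + n * n ∧
    (Prog.prepare.run s).reg 5 = min (s.reg 1) (s.reg 2) + 1 ∧
    ∀ u < n, (Prog.prepare.run s).arr 2 u = u * n := by
  have h₁ := run_multiples (s := Prog.capacity.run s) ((Prog.run_reg rfl s).trans hn)
    ((Prog.run_reg rfl s).trans h₃)
  have h₂ : (Prog.multiples.run (Prog.capacity.run s)).reg 5 = (Prog.capacity.run s).reg 5 :=
    Prog.run_reg rfl _
  rw [run_capacity] at h₂
  simp [Prog.prepare, Prog.run, h₁.1, h₂]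
  exact h₁.2

open Classical in
theorem run_tabulate {n : ℕ} {G : SimpleGraph (Fin n)} {s : State} (hn : s.reg 0 = n)
    (h₃ : s.reg 3 = n * n) (h₄ : s.reg 4 = n * n + n * n)
    (hadj : ∀ u v, s.arr 1 (code u v) = if G.Adj u v then 1 else 0)
    (hb : ∀ u : Fin n, s.arr 2 u = u * n) : Tables G (Prog.tabulate.run s) := by
  let P (s' : State) (u v : Fin n) : Prop := s'.arr 3 (code u v) = u ∧ s'.arr 4 (code u v) = v ∧
    s'.arr 5 (code u v) = if Gᶜ.Adj u v then 1 else 0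
  have step : ∀ s' : State, ∀ u v : Fin n, s'.arr 1 = s.arr 1 → s'.arr 2 = s.arr 2 →
      s'.reg 10 = u → s'.reg 11 = v → P (Prog.tabulatePair.run s') u v ∧
        ∀ u' v', P s' u' v' → P (Prog.tabulatePair.run s') u' v' := by
    intro s' u v h₁ h₂ hu hv
    have hc : (s'.arr 2 u + v : ℕ) = code u v := by rw [h₂, hb]; rfl
    -- The sum of both truncated differences is the machine's test for inequality.
    have hH : ((u : ℕ) - v + (v - u) ≠ 0) ↔ u ≠ v := by rw [ne_eq, ne_eq, Fin.ext_iff]; omega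
    have hrun : ∀ a p q, (Prog.tabulatePair.run s').arr a (code p q) =
        if p = u ∧ q = v then (if a = 3 then u.1 else if a = 4 then v.1 else
          if a = 5 then (if Gᶜ.Adj u v then 1 else 0) else s'.arr a (code p q))
        else s'.arr a (code p q) := by
      intro a p q
      have h1 := hadj u v
      rw [← h₁] at h1
      simp only [Prog.tabulatePair, Prog.run, Expr.eval, State.reg_setReg, State.reg_setArr,
        Nat.reduceEqDiff, if_false, if_true, hu, hv, hc, hH]
      by_cases huv : u = v
      · have : ¬ Gᶜ.Adj u v := by rw [huv]; exact Gᶜ.loopless.irrefl v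
        by_cases hpq : p = u ∧ q = v
        · simp [huv, hpq]
          split_ifs <;> simp_all
        · simp [huv, code_inj]
          split_ifs <;> simp_all
      · by_cases hpq : p = u ∧ q = v
        · simp [huv, hpq, SimpleGraph.compl_adj]
          split_ifs <;> simp_all
        · simp [huv, hpq, code_inj]
    refine ⟨by simp [P, hrun], fun u' v' hP => ?_⟩
    obtain ⟨p₁, p₂, p₃⟩ := hP
    simp only [P, hrun]
    by_cases h : u' = u ∧ v' = v
    · obtain ⟨rfl, rfl⟩ := h
      simp
    · simp [h, p₁, p₂, p₃]
  have hF := Prog.frame_run Prog.tabulate s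
  have key : ∀ u v, P (Prog.tabulate.run s) u v := by
    have := Prog.run_loop (x := 10) (r := 0) (p := .loop 11 0 Prog.tabulatePair)
      (fun i s' => ∀ u v : Fin n, u.1 < i → P s' u v) s
      (by intro u v h; omega) (by
        intro i hi s' hF' hr hI
        have hin := Prog.run_loop (x := 11) (r := 0) (p := Prog.tabulatePair)
          (fun j s'' => ∀ u v : Fin n, u.1 < i ∨ u.1 = i ∧ v.1 < j → P s'' u v) s'
          (by intro u v h; exact hI u v (by omega)) (by
            intro j hj s'' hF'' hr' hI' u v huv
            have hn' : s'.reg 0 = n := (hF'.reg 0 rfl).trans hn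
            obtain ⟨k₁, k₂⟩ := step s'' ⟨i, by omega⟩ ⟨j, by omega⟩
              ((hF''.arr 1 rfl).trans (hF'.arr 1 rfl)) ((hF''.arr 2 rfl).trans (hF'.arr 2 rfl))
              ((hF''.reg 10 rfl).trans hr) hr'
            change P (Prog.tabulatePair.run s'') u v
            by_cases h : u.1 = i ∧ v.1 = j
            · obtain ⟨rfl, rfl⟩ := h
              exact k₁
            · exact k₂ u v (hI' u v (by omega)))
        have hn' : s'.reg 0 = n := (hF'.reg 0 rfl).trans hn
        intro u v huv
        exact hin u v (by have := v.2; omega))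
    intro u v
    exact this u v (by rw [hn]; exact u.2)
  exact
    { size := (hF.reg 0 rfl).trans hn
      pairs := (hF.reg 3 rfl).trans h₃
      rounds := (hF.reg 4 rfl).trans h₄
      adj := by rw [hF.arr 1 rfl]; exact hadj
      base := by rw [hF.arr 2 rfl]; exact hb
      fst := fun u v => (key u v).1
      snd := fun u v => (key u v).2.1
      nonadj := fun u v => (key u v).2.2 }

/-! ### Orientation -/

/-- The pairs of vertices that are oriented. -/
def oriented {n : ℕ} (s : State) (u v : Fin n) : Prop := s.arr 6 (code u v) ≠ 0

/-- The queue, of length `reg 14`, lists the oriented pairs. -/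
structure Queue {n : ℕ} (G : SimpleGraph (Fin n)) (s : State) : Prop where
  inj : ∀ i < s.reg 14, ∀ j < s.reg 14, s.arr 7 i = s.arr 7 j → i = j
  exists_eq : ∀ i < s.reg 14, ∃ u v : Fin n, s.arr 7 i = code u v ∧ oriented s u v
  exists_index : ∀ u v : Fin n, oriented s u v → ∃ i < s.reg 14, s.arr 7 i = code u v
  edge : ∀ u v : Fin n, oriented s u v → Gᶜ.Adj u v

theorem Queue.le {n : ℕ} {G : SimpleGraph (Fin n)} {s : State} (h : Queue G s) :
    s.reg 14 ≤ n * n := by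
  have := Finset.card_le_card_of_injOn (s := Finset.range (s.reg 14))
    (t := Finset.range (n * n)) (s.arr 7) (by
      intro i hi
      obtain ⟨u, v, h₁, -⟩ := h.exists_eq i (by simpa using hi)
      rw [h₁]
      simpa using code_lt u v) (by
      intro i hi j hj hij
      exact h.inj i (by simpa using hi) j (by simpa using hj) hij)
  simpa using this

/-- The queue of `s'` extends the queue of `s`. -/
structure QueueExtends (s s' : State) : Prop where
  le : s.reg 14 ≤ s'.reg 14
  eq : ∀ i < s.reg 14, s'.arr 7 i = s.arr 7 i

theorem QueueExtends.trans {s s' s'' : State} (h : QueueExtends s s') (h' : QueueExtends s' s'') :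
    QueueExtends s s'' :=
  ⟨h.le.trans h'.le, fun i hi => (h'.eq i (hi.trans_le h.le)).trans (h.eq i hi)⟩

/-- The queues of `s` and `s'` are the same. -/
structure SameQueue (s s' : State) : Prop where
  length : s'.reg 14 = s.reg 14
  arr_six : s'.arr 6 = s.arr 6
  arr_seven : s'.arr 7 = s.arr 7

theorem SameQueue.oriented {n : ℕ} {s s' : State} (h : SameQueue s s') (u v : Fin n) :
    oriented s' u v ↔ oriented s u v := by
  rw [WCOC.oriented, WCOC.oriented, h.arr_six]

theorem SameQueue.extends {s s' : State} (h : SameQueue s s') : QueueExtends s s' :=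
  ⟨h.length.ge, fun i _ => by rw [h.arr_seven]⟩

theorem SameQueue.queue {n : ℕ} {G : SimpleGraph (Fin n)} {s s' : State} (h : SameQueue s s')
    (hs : Queue G s) : Queue G s' where
  inj := by rw [h.length, h.arr_seven]; exact hs.inj
  exists_eq := by
    rw [h.length, h.arr_seven]
    simpa only [h.oriented] using hs.exists_eq
  exists_index := by
    rw [h.length, h.arr_seven]
    simpa only [h.oriented] using hs.exists_index
  edge := by simpa only [h.oriented] using hs.edge

theorem run_push {n : ℕ} {G : SimpleGraph (Fin n)} {s : State} (h : Queue G s) {u v : Fin n}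
    (hc : s.reg 20 = code u v) (huv : Gᶜ.Adj u v) :
    Queue G (Prog.push.run s) ∧ QueueExtends s (Prog.push.run s) ∧
    ∀ x y : Fin n, oriented (Prog.push.run s) x y ↔ oriented s x y ∨ x = u ∧ y = v := by
  by_cases ho : s.arr 6 (code u v) = 0
  · have h₆ : ∀ c, (Prog.push.run s).arr 6 c = if c = code u v then 1 else s.arr 6 c := by
      simp [Prog.push, Prog.run, hc, ho]
    have h₇ : ∀ i, (Prog.push.run s).arr 7 i = if i = s.reg 14 then code u v else s.arr 7 i := by
      simp [Prog.push, Prog.run, hc, ho]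
    have h₁₄ : (Prog.push.run s).reg 14 = s.reg 14 + 1 := by
      simp [Prog.push, Prog.run, hc, ho]
    have hor : ∀ x y : Fin n, oriented (Prog.push.run s) x y ↔
        oriented s x y ∨ x = u ∧ y = v := by
      intro x y
      rw [oriented, oriented, h₆]
      by_cases hxy : x = u ∧ y = v
      · simp [hxy]
      · rw [if_neg (by rwa [code_inj])]
        simp [hxy]
    have hne : ∀ i < s.reg 14, s.arr 7 i ≠ code u v := by
      intro i hi he
      obtain ⟨x, y, h₁, h₂⟩ := h.exists_eq i hi
      rw [oriented, ← h₁, he] at h₂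
      exact h₂ ho
    refine ⟨⟨?_, ?_, ?_, ?_⟩, ⟨by omega, fun i hi => by rw [h₇, if_neg hi.ne]⟩, hor⟩
    · intro i hi j hj hij
      rw [h₁₄] at hi hj
      rw [h₇, h₇] at hij
      split_ifs at hij with h₁ h₂ h₂
      · omega
      · exact absurd hij.symm (hne j (by omega))
      · exact absurd hij (hne i (by omega))
      · exact h.inj i (by omega) j (by omega) hij
    · intro i hi
      rw [h₁₄] at hi
      rw [h₇]
      split_ifs with h₁
      · exact ⟨u, v, rfl, (hor u v).2 (.inr ⟨rfl, rfl⟩)⟩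
      · obtain ⟨x, y, h₂, h₃⟩ := h.exists_eq i (by omega)
        exact ⟨x, y, h₂, (hor x y).2 (.inl h₃)⟩
    · intro x y hxy
      rw [h₁₄]
      rcases (hor x y).1 hxy with h₁ | ⟨rfl, rfl⟩
      · obtain ⟨i, hi, h₂⟩ := h.exists_index x y h₁
        exact ⟨i, by omega, by rw [h₇, if_neg hi.ne, h₂]⟩
      · exact ⟨s.reg 14, by omega, by rw [h₇, if_pos rfl]⟩
    · intro x y hxy
      rcases (hor x y).1 hxy with h₁ | ⟨rfl, rfl⟩
      · exact h.edge x y h₁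
      · exact huv
  · have : Prog.push.run s = s := by simp [Prog.push, Prog.run, hc, ho]
    rw [this]
    refine ⟨h, ⟨le_rfl, fun _ _ => rfl⟩, fun x y => ⟨.inl, ?_⟩⟩
    rintro (h | ⟨rfl, rfl⟩)
    · exact h
    · exact ho

open Classical in
theorem run_pushForced {n : ℕ} {G : SimpleGraph (Fin n)} {s : State} (hT : Tables G s)
    (h : Queue G s) {u v p q : Fin n} (hc : s.reg 20 = code u v) (hd : s.reg 21 = code p q) :
    Queue G (Prog.pushForced.run s) ∧ QueueExtends s (Prog.pushForced.run s) ∧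
    ∀ x y : Fin n, oriented (Prog.pushForced.run s) x y ↔ oriented s x y ∨
      (x = u ∧ y = v) ∧ Gᶜ.Adj u v ∧ (¬ Gᶜ.Adj p q ∨ oriented s p q) := by
  by_cases huv : Gᶜ.Adj u v ∧ (¬ Gᶜ.Adj p q ∨ oriented s p q)
  · have : Prog.pushForced.run s = Prog.push.run s := by
      simp only [Prog.pushForced, Prog.run, Expr.eval, hc, hd, hT.nonadj]
      rw [if_pos (by simp [huv.1]), if_pos]
      rcases huv.2 with h | h
      · simp [h]
      · rw [oriented] at h
        omega
    rw [this]
    obtain ⟨h₁, h₂, h₃⟩ := run_push h hc huv.1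
    refine ⟨h₁, h₂, fun x y => ?_⟩
    rw [h₃]
    tauto
  · have : Prog.pushForced.run s = s := by
      simp only [Prog.pushForced, Prog.run, Expr.eval, hc, hd, hT.nonadj]
      by_cases h₁ : Gᶜ.Adj u v
      · rw [if_pos (by simp [h₁]), if_neg]
        have : Gᶜ.Adj p q ∧ ¬ oriented s p q := by tauto
        rw [oriented, not_not] at this
        simp [this.1, this.2]
      · rw [if_neg (by simp [h₁])]
    rw [this]
    refine ⟨h, ⟨le_rfl, fun _ _ => rfl⟩, fun x y => ?_⟩
    tauto

theorem run_propagateAt {n : ℕ} {G : SimpleGraph (Fin n)} {s : State} (hT : Tables G s)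
    (h : Queue G s) {u v x : Fin n} (hu : s.reg 17 = u) (hv : s.reg 18 = v) (hx : s.reg 19 = x) :
    Queue G (Prog.propagateAt.run s) ∧ QueueExtends s (Prog.propagateAt.run s) ∧
    ∃ D : Fin n → Fin n → Prop,
      (∀ p q, D p q ↔ oriented s p q ∨
        (p = u ∧ q = x) ∧ Gᶜ.Adj u x ∧ (¬ Gᶜ.Adj v x ∨ oriented s v x)) ∧
      ∀ p q, oriented (Prog.propagateAt.run s) p q ↔ D p q ∨
        (p = x ∧ q = v) ∧ Gᶜ.Adj x v ∧ (¬ Gᶜ.Adj x u ∨ D x u) := by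
  let s₁ : State := (s.setReg 20 (code u x)).setReg 21 (code v x)
  let s₂ : State := Prog.pushForced.run s₁
  let s₃ : State := (s₂.setReg 20 (code x v)).setReg 21 (code x u)
  have hr : Prog.propagateAt.run s = Prog.pushForced.run s₃ := by
    have h₂ : s₂.arr 2 = s.arr 2 := Prog.run_arr rfl s₁
    have h₁₇ : s₂.reg 17 = u := (Prog.run_reg rfl s₁).trans (by simp [s₁, hu])
    have h₁₈ : s₂.reg 18 = v := (Prog.run_reg rfl s₁).trans (by simp [s₁, hv])
    have h₁₉ : s₂.reg 19 = x := (Prog.run_reg rfl s₁).trans (by simp [s₁, hx])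
    have e₁ : ((s.setReg 20 (s.arr 2 (s.reg 17) + s.reg 19)).setReg 21
        (s.arr 2 (s.reg 18) + s.reg 19)) = s₁ := by
      simp only [s₁, hu, hv, hx, hT.base]; rfl
    have e₂ : ((s₂.setReg 20 (s₂.arr 2 (s₂.reg 19) + s₂.reg 18)).setReg 21
        (s₂.arr 2 (s₂.reg 19) + s₂.reg 17)) = s₃ := by
      simp only [s₃, h₂, h₁₇, h₁₈, h₁₉, hT.base]; rfl
    simp only [Prog.propagateAt, Prog.run, Expr.eval]
    simp only [State.arr_setReg, State.reg_setReg, Nat.reduceEqDiff, if_false, e₁]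
    rw [← e₂]
  have q₁ : SameQueue s s₁ := ⟨by simp [s₁], rfl, rfl⟩
  have t₁ : Tables G s₁ := hT.of_eq (by simp [s₁]) (by simp [s₁]) (by simp [s₁])
    (fun _ _ _ => rfl)
  obtain ⟨a₁, a₂, a₃⟩ := run_pushForced t₁ (q₁.queue h) (u := u) (v := x) (p := v) (q := x)
    (by simp [s₁]) (by simp [s₁])
  have t₂ : Tables G s₂ := t₁.frame (Prog.frame_run _ _) rfl
  have q₂ : SameQueue s₂ s₃ := ⟨by simp [s₃], rfl, rfl⟩
  have t₃ : Tables G s₃ := t₂.of_eq (by simp [s₃]) (by simp [s₃]) (by simp [s₃])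
    (fun _ _ _ => rfl)
  obtain ⟨b₁, b₂, b₃⟩ := run_pushForced t₃ (q₂.queue a₁) (u := x) (v := v) (p := x) (q := u)
    (by simp [s₃]) (by simp [s₃])
  rw [hr]
  refine ⟨b₁, q₁.extends.trans (a₂.trans (q₂.extends.trans b₂)), oriented s₂, ?_, ?_⟩
  · intro p q
    rw [a₃]
    simp only [q₁.oriented]
  · intro p q
    rw [b₃]
    simp only [q₂.oriented]

/-- The state after the orientations forced by `(u, v)` and the vertices less than `i`. -/
structure Propagated {n : ℕ} (G : SimpleGraph (Fin n)) (s : State) (u v : Fin n) (i : ℕ)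
    (s' : State) : Prop where
  queue : Queue G s'
  ext : QueueExtends s s'
  mono : ∀ p q : Fin n, oriented s p q → oriented s' p q
  right : ∀ x : Fin n, x < i → Gᶜ.Adj u x → (¬ Gᶜ.Adj v x ∨ oriented s v x) → oriented s' u x
  left : ∀ x : Fin n, x < i → Gᶜ.Adj x v → (¬ Gᶜ.Adj x u ∨ oriented s x u) → oriented s' x v
  subset : ∀ D, PartialOrientation Gᶜ.Adj D → (∀ p q, oriented s p q → D p q) →
    ∀ p q, oriented s' p q → D p q

theorem run_propagate {n : ℕ} {G : SimpleGraph (Fin n)} {s : State} (hT : Tables G s)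
    (h : Queue G s) {u v : Fin n} (hu : s.reg 17 = u) (hv : s.reg 18 = v) (huv : oriented s u v) :
    Propagated G s u v n ((Prog.loop 19 0 Prog.propagateAt).run s) := by
  suffices Propagated G s u v (s.reg 0) ((Prog.loop 19 0 Prog.propagateAt).run s) by
    rwa [hT.size] at this
  refine Prog.run_loop (x := 19) (r := 0) (p := Prog.propagateAt) (Propagated G s u v) s ?_ ?_
  · have q : SameQueue s (s.setReg 19 0) := ⟨by simp, rfl, rfl⟩
    exact ⟨q.queue h, q.extends, fun _ _ h => h, fun x hx => by omega, fun x hx => by omega,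
      fun D _ h => h⟩
  · intro i hi s' hF hr hI
    rw [hT.size] at hi
    obtain ⟨h₁, h₂, D, h₃, h₄⟩ := run_propagateAt (u := u) (v := v) (x := ⟨i, hi⟩)
      (hT.frame hF rfl) hI.queue ((hF.reg 17 rfl).trans hu) ((hF.reg 18 rfl).trans hv) hr
    have q : SameQueue (Prog.propagateAt.run s') ((Prog.propagateAt.run s').setReg 19 (i + 1)) :=
      ⟨by simp, rfl, rfl⟩
    have hmono : ∀ p q : Fin n, oriented s' p q → oriented (Prog.propagateAt.run s') p q :=
      fun p q h => (h₄ p q).2 (.inl ((h₃ p q).2 (.inl h)))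
    refine ⟨q.queue h₁, hI.ext.trans (h₂.trans q.extends), fun p q h => ?_, ?_, ?_, ?_⟩
    · exact hmono p q (hI.mono p q h)
    · intro x hx k₁ k₂
      by_cases hxi : x.1 = i
      · obtain rfl : x = ⟨i, hi⟩ := Fin.ext hxi
        exact (h₄ _ _).2 (.inl ((h₃ _ _).2 (.inr ⟨⟨rfl, rfl⟩, k₁, k₂.imp_right (hI.mono _ _)⟩)))
      · exact hmono _ _ (hI.right x (by omega) k₁ k₂)
    · intro x hx k₁ k₂
      by_cases hxi : x.1 = i
      · obtain rfl : x = ⟨i, hi⟩ := Fin.ext hxi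
        exact (h₄ _ _).2 (.inr ⟨⟨rfl, rfl⟩, k₁, k₂.imp_right fun h =>
          (h₃ _ _).2 (.inl (hI.mono _ _ h))⟩)
      · exact hmono _ _ (hI.left x (by omega) k₁ k₂)
    · intro E hE hsE
      have hs'E := hI.subset E hE hsE
      have hDE : ∀ p q, D p q → E p q := by
        intro p q hpq
        rcases (h₃ p q).1 hpq with h | ⟨⟨rfl, rfl⟩, k₁, k₂⟩
        · exact hs'E _ _ h
        · rcases k₂ with k₂ | k₂
          · exact hE.right (hsE _ _ huv) k₁ k₂
          · exact hE.trans (hsE _ _ huv) (hs'E _ _ k₂)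
      intro p q hpq
      rcases (h₄ p q).1 hpq with h | ⟨⟨rfl, rfl⟩, k₁, k₂⟩
      · exact hDE _ _ h
      · rcases k₂ with k₂ | k₂
        · exact hE.left (hsE _ _ huv) k₁ k₂
        · exact hE.trans (hDE _ _ k₂) (hsE _ _ huv)

/-- The invariant of the orientation. -/
structure Orienting {n : ℕ} (G : SimpleGraph (Fin n)) (i : ℕ) (s : State) : Prop where
  queue : Queue G s
  head_le : s.reg 13 ≤ s.reg 14
  next_le : s.reg 15 ≤ n * n
  right : ∀ i < s.reg 13, ∀ u v : Fin n, s.arr 7 i = code u v → ∀ x, Gᶜ.Adj u x →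
    ¬ Gᶜ.Adj v x → oriented s u x
  left : ∀ i < s.reg 13, ∀ u v : Fin n, s.arr 7 i = code u v → ∀ x, Gᶜ.Adj x v →
    ¬ Gᶜ.Adj x u → oriented s x v
  trans : ∀ i < s.reg 13, ∀ j < s.reg 13, ∀ u v x : Fin n, s.arr 7 i = code u v →
    s.arr 7 j = code v x → oriented s u x
  total : ∀ u v : Fin n, code u v < s.reg 15 → Gᶜ.Adj u v → oriented s u v ∨ oriented s v u
  sound : ∃ D : Fin n → Fin n → Prop, PartialOrientation Gᶜ.Adj D ∧
    ∀ u v, oriented s u v → D u v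
  progress : i ≤ s.reg 13 + s.reg 15 ∨ s.reg 13 = s.reg 14 ∧ s.reg 15 = n * n

theorem Orienting.partialOrientation {n : ℕ} {G : SimpleGraph (Fin n)} {i : ℕ} {s : State}
    (h : Orienting G i s) (he : s.reg 13 = s.reg 14) :
    PartialOrientation Gᶜ.Adj (oriented (n := n) s) := by
  obtain ⟨D, hD, hsub⟩ := h.sound
  refine ⟨⟨?_, ?_⟩, h.queue.edge _ _, ?_, fun u hu => hD.irrefl u (hsub _ _ hu)⟩
  · intro u v x huv h₁ h₂
    obtain ⟨i, hi, e⟩ := h.queue.exists_index u v huv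
    exact h.right i (he ▸ hi) u v e x h₁ h₂
  · intro u v x huv h₁ h₂
    obtain ⟨i, hi, e⟩ := h.queue.exists_index u v huv
    exact h.left i (he ▸ hi) u v e x h₁ h₂
  · intro u v x huv hvx
    obtain ⟨i, hi, e⟩ := h.queue.exists_index u v huv
    obtain ⟨j, hj, e'⟩ := h.queue.exists_index v x hvx
    exact h.trans i (he ▸ hi) j (he ▸ hj) u v x e e'

theorem Orienting.of_same {n : ℕ} {G : SimpleGraph (Fin n)} {i : ℕ} {s s' : State}
    (h : Orienting G i s) (q : SameQueue s s') (h₁₃ : s'.reg 13 = s.reg 13)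
    (h₁₅ : s'.reg 15 = s.reg 15) : Orienting G i s' where
  queue := q.queue h.queue
  head_le := by rw [h₁₃, q.length]; exact h.head_le
  next_le := by rw [h₁₅]; exact h.next_le
  right := by rw [h₁₃, q.arr_seven]; simpa only [q.oriented] using h.right
  left := by rw [h₁₃, q.arr_seven]; simpa only [q.oriented] using h.left
  trans := by rw [h₁₃, q.arr_seven]; simpa only [q.oriented] using h.trans
  total := by rw [h₁₅]; simpa only [q.oriented] using h.total
  sound := by simpa only [q.oriented] using h.sound
  progress := by rw [h₁₃, h₁₅, q.length]; exact h.progress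

theorem Orienting.processNext {n : ℕ} {G : SimpleGraph (Fin n)} {i : ℕ} {s : State}
    (hT : Tables G s) (h : Orienting G i s) (hlt : s.reg 13 < s.reg 14) :
    Orienting G (i + 1) (Prog.processNext.run s) := by
  obtain ⟨u, v, hc, huv⟩ := h.queue.exists_eq _ hlt
  let s₁ : State := (((s.setReg 12 (code u v)).setReg 13 (s.reg 13 + 1)).setReg 17 u).setReg 18 v
  have hr : Prog.processNext.run s = (Prog.loop 19 0 Prog.propagateAt).run s₁ := by
    rw [Prog.processNext]
    generalize Prog.loop 19 0 Prog.propagateAt = p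
    simp [Prog.run, s₁, hc, hT.fst, hT.snd]
  have q : SameQueue s s₁ := ⟨by simp [s₁], rfl, rfl⟩
  have hT₁ : Tables G s₁ := hT.of_eq (by simp [s₁]) (by simp [s₁]) (by simp [s₁])
    (fun _ _ _ => rfl)
  have hP := run_propagate hT₁ (q.queue h.queue) (u := u) (v := v) (by simp [s₁]) (by simp [s₁])
    ((q.oriented _ _).2 huv)
  have hF := Prog.frame_run (Prog.loop 19 0 Prog.propagateAt) s₁
  rw [hr]
  generalize (Prog.loop 19 0 Prog.propagateAt).run s₁ = s' at hP hF
  have h₁₃ : s'.reg 13 = s.reg 13 + 1 := (hF.reg 13 rfl).trans (by simp [s₁])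
  have h₁₅ : s'.reg 15 = s.reg 15 := (hF.reg 15 rfl).trans (by simp [s₁])
  have hle : s.reg 14 ≤ s'.reg 14 := q.length ▸ hP.ext.le
  have h₇ : ∀ i < s.reg 14, s'.arr 7 i = s.arr 7 i := fun i hi => hP.ext.eq i (q.length ▸ hi)
  have hmono : ∀ p q : Fin n, oriented s p q → oriented s' p q := hP.mono
  refine ⟨hP.queue, by omega, h₁₅ ▸ h.next_le, ?_, ?_, ?_, ?_, ?_, ?_⟩
  · intro j hj p r hpr x h₁ h₂
    rw [h₁₃] at hj
    rw [h₇ j (by omega)] at hpr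
    rcases Nat.lt_succ_iff_lt_or_eq.1 hj with hj | rfl
    · exact hmono _ _ (h.right j hj p r hpr x h₁ h₂)
    · obtain ⟨rfl, rfl⟩ := code_inj.1 (hc.symm.trans hpr)
      exact hP.right x x.2 h₁ (.inl h₂)
  · intro j hj p r hpr x h₁ h₂
    rw [h₁₃] at hj
    rw [h₇ j (by omega)] at hpr
    rcases Nat.lt_succ_iff_lt_or_eq.1 hj with hj | rfl
    · exact hmono _ _ (h.left j hj p r hpr x h₁ h₂)
    · obtain ⟨rfl, rfl⟩ := code_inj.1 (hc.symm.trans hpr)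
      exact hP.left x x.2 h₁ (.inl h₂)
  · have hor : ∀ j < s.reg 14, ∀ p r : Fin n, s.arr 7 j = code p r → oriented s p r := by
      intro j hj p r hpr
      obtain ⟨p', r', h₁, h₂⟩ := h.queue.exists_eq j hj
      obtain ⟨rfl, rfl⟩ := code_inj.1 (h₁.symm.trans hpr)
      exact h₂
    obtain ⟨D, hD, hsub⟩ := h.sound
    intro j hj j' hj' p r x hpr hrx
    rw [h₁₃] at hj hj'
    rw [h₇ j (by omega)] at hpr
    rw [h₇ j' (by omega)] at hrx
    have o₁ := hor j (by omega) _ _ hpr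
    have o₂ := hor j' (by omega) _ _ hrx
    have hpx : Gᶜ.Adj p x := hD.edge (hD.trans (hsub _ _ o₁) (hsub _ _ o₂))
    rcases Nat.lt_succ_iff_lt_or_eq.1 hj with hj | rfl
    · rcases Nat.lt_succ_iff_lt_or_eq.1 hj' with hj' | rfl
      · exact hmono _ _ (h.trans j hj j' hj' p r x hpr hrx)
      · obtain ⟨rfl, rfl⟩ := code_inj.1 (hc.symm.trans hrx)
        exact hP.left p p.2 hpx (.inr o₁)
    · obtain ⟨rfl, rfl⟩ := code_inj.1 (hc.symm.trans hpr)
      exact hP.right x x.2 hpx (.inr o₂)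
  · intro p r hpr h₁
    rw [h₁₅] at hpr
    exact (h.total p r hpr h₁).imp (hmono _ _) (hmono _ _)
  · obtain ⟨D, hD, hsub⟩ := h.sound
    exact ⟨D, hD, hP.subset D hD hsub⟩
  · have := h.progress
    omega

theorem run_tryNext {n : ℕ} {G : SimpleGraph (Fin n)} {s : State} (hT : Tables G s)
    (h : Queue G s) {u v : Fin n} (hc : s.reg 15 = code u v) :
    (Prog.tryNext.run s).reg 15 = s.reg 15 + 1 ∧ Queue G (Prog.tryNext.run s) ∧
    QueueExtends s (Prog.tryNext.run s) ∧
    ∀ x y : Fin n, oriented (Prog.tryNext.run s) x y ↔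
      oriented s x y ∨ (x = u ∧ y = v) ∧ Gᶜ.Adj u v ∧ ¬ oriented s v u := by
  classical
  let s₁ : State := ((s.setReg 20 (code u v)).setReg 21 (code v u)).setReg 15 (code u v + 1)
  have hr : Prog.tryNext.run s = (Prog.ite (.get 5 (.reg 20))
      (.ite (.get 6 (.reg 21)) .skip Prog.push) .skip).run s₁ := by
    have hb := hT.base v
    rw [Prog.tryNext]
    generalize Prog.ite (.get 5 (.reg 20)) (.ite (.get 6 (.reg 21)) .skip Prog.push) .skip = p
    simp [Prog.run, s₁, hc, hT.fst, hT.snd, hb]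
    rfl
  have q : SameQueue s s₁ := ⟨by simp [s₁], rfl, rfl⟩
  rw [hr, Prog.run_reg rfl]
  refine ⟨by simp [s₁, hc], ?_⟩
  by_cases huv : Gᶜ.Adj u v ∧ ¬ oriented s v u
  · obtain ⟨h₁, h₂, h₃⟩ := run_push (q.queue h) (u := u) (v := v) (by simp [s₁]) huv.1
    have : (Prog.ite (.get 5 (.reg 20)) (.ite (.get 6 (.reg 21)) .skip Prog.push) .skip).run s₁ =
        Prog.push.run s₁ := by
      have := huv.2
      rw [oriented, not_not] at this
      rw [Prog.run_ite_pos (by simp [s₁, hT.nonadj, huv.1]),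
        Prog.run_ite_neg (by simp [s₁, this])]
    rw [this]
    refine ⟨h₁, q.extends.trans h₂, fun x y => ?_⟩
    rw [h₃, q.oriented]
    tauto
  · have : (Prog.ite (.get 5 (.reg 20)) (.ite (.get 6 (.reg 21)) .skip Prog.push) .skip).run s₁ =
        s₁ := by
      by_cases h₁ : Gᶜ.Adj u v
      · have h₂ : oriented s v u := by tauto
        rw [oriented] at h₂
        rw [Prog.run_ite_pos (by simp [s₁, hT.nonadj, h₁]), Prog.run_ite_pos (by simp [s₁, h₂])]
        rfl
      · rw [Prog.run_ite_neg (by simp [s₁, hT.nonadj, h₁])]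
        rfl
    rw [this]
    refine ⟨q.queue h, q.extends, fun x y => ?_⟩
    rw [q.oriented]
    tauto

theorem Orienting.tryNext {n : ℕ} {G : SimpleGraph (Fin n)} {i : ℕ} {s : State}
    (hG : IsIntervalGraph G) (hT : Tables G s) (h : Orienting G i s) (he : s.reg 13 = s.reg 14)
    (hlt : s.reg 15 < n * n) : Orienting G (i + 1) (Prog.tryNext.run s) := by
  obtain ⟨u, v, hc⟩ := exists_code hlt
  obtain ⟨h₁₅, hQ, hX, ho⟩ := run_tryNext hT h.queue hc.symm
  have hF := Prog.frame_run Prog.tryNext s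
  generalize Prog.tryNext.run s = s' at *
  have h₁₃ : s'.reg 13 = s.reg 13 := hF.reg 13 rfl
  have hle := hX.le
  have hmono : ∀ p q : Fin n, oriented s p q → oriented s' p q := fun p q h => (ho p q).2 (.inl h)
  refine ⟨hQ, by omega, by omega, ?_, ?_, ?_, ?_, ?_, ?_⟩
  · intro j hj p r hpr x h₁ h₂
    rw [h₁₃] at hj
    rw [hX.eq j (by omega)] at hpr
    exact hmono _ _ (h.right j hj p r hpr x h₁ h₂)
  · intro j hj p r hpr x h₁ h₂
    rw [h₁₃] at hj
    rw [hX.eq j (by omega)] at hpr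
    exact hmono _ _ (h.left j hj p r hpr x h₁ h₂)
  · intro j hj j' hj' p r x hpr hrx
    rw [h₁₃] at hj hj'
    rw [hX.eq j (by omega)] at hpr
    rw [hX.eq j' (by omega)] at hrx
    exact hmono _ _ (h.trans j hj j' hj' p r x hpr hrx)
  · intro p r hpr h₁
    rw [h₁₅] at hpr
    rcases Nat.lt_succ_iff_lt_or_eq.1 hpr with hpr | hpr
    · exact (h.total p r hpr h₁).imp (hmono _ _) (hmono _ _)
    · obtain ⟨rfl, rfl⟩ := code_inj.1 (hpr.trans hc.symm)
      by_cases h₂ : oriented s r p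
      · exact .inr (hmono _ _ h₂)
      · exact .inl ((ho p r).2 (.inr ⟨⟨rfl, rfl⟩, h₁, h₂⟩))
  · have hP := h.partialOrientation he
    by_cases hn : Gᶜ.Adj u v ∧ ¬ oriented s v u ∧ ¬ oriented s u v
    · obtain ⟨R, hR, hRt⟩ := hG.exists_orientation
      obtain ⟨D, hD, hsub, huv⟩ := hR.extend (fun h => h.symm) (fun u => Gᶜ.loopless.irrefl u)
        hRt hP hn.1 hn.2.2 hn.2.1
      refine ⟨D, hD, fun p q hpq => ?_⟩
      rcases (ho p q).1 hpq with h | ⟨⟨rfl, rfl⟩, -⟩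
      · exact hsub _ _ h
      · exact huv
    · refine ⟨_, hP, fun p q hpq => ?_⟩
      rcases (ho p q).1 hpq with h | ⟨⟨rfl, rfl⟩, h₁, h₂⟩
      · exact h
      · by_contra h₃
        exact hn ⟨h₁, h₂, h₃⟩
  · have := h.progress
    omega

theorem run_orient {n : ℕ} {G : SimpleGraph (Fin n)} (hG : IsIntervalGraph G) {s : State}
    (hT : Tables G s) (h₁₃ : s.reg 13 = 0) (h₁₄ : s.reg 14 = 0) (h₁₅ : s.reg 15 = 0)
    (h₆ : ∀ c, s.arr 6 c = 0) :
    PartialOrientation Gᶜ.Adj (oriented (n := n) (Prog.orient.run s)) ∧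
    ∀ {u v : Fin n}, Gᶜ.Adj u v →
      oriented (Prog.orient.run s) u v ∨ oriented (Prog.orient.run s) v u := by
  have hno : ∀ u v : Fin n, ¬ oriented s u v := fun u v h => h (h₆ _)
  obtain ⟨R, hR, hRt⟩ := hG.exists_orientation
  have h0 : Orienting G 0 s := by
    refine ⟨⟨?_, ?_, ?_, ?_⟩, ?_, ?_, ?_, ?_, ?_, ?_, ?_, ?_⟩
    · intro i hi; omega
    · intro i hi; omega
    · exact fun u v h => absurd h (hno u v)
    · exact fun u v h => absurd h (hno u v)
    · omega
    · omega
    · intro i hi; omega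
    · intro i hi; omega
    · intro i hi; omega
    · intro u v huv; omega
    · exact ⟨R, hR, fun u v h => absurd h (hno u v)⟩
    · exact .inl (Nat.zero_le _)
  have same : ∀ (s : State) (i : ℕ), SameQueue s (s.setReg 16 i) := fun s i =>
    ⟨by simp, rfl, rfl⟩
  have key := Prog.run_loop (x := 16) (r := 4) (p := .ite (.sub (.reg 14) (.reg 13))
    Prog.processNext (.ite (.sub (.reg 3) (.reg 15)) Prog.tryNext .skip)) (Orienting G) s
    (h0.of_same (same _ _) (by simp) (by simp)) (by
      intro i hi s' hF hr hI
      have hT' : Tables G s' := hT.frame hF rfl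
      suffices Orienting G (i + 1) ((Prog.ite (.sub (.reg 14) (.reg 13))
          Prog.processNext (.ite (.sub (.reg 3) (.reg 15)) Prog.tryNext .skip)).run s') from
        this.of_same (same _ _) (by simp) (by simp)
      have h₁ := hI.head_le
      have h₂ := hI.next_le
      simp only [Prog.run, Expr.eval, hT'.pairs]
      split_ifs with h₃ h₄
      · exact hI.processNext hT' (by omega)
      · exact hI.tryNext hG hT' (by omega) (by omega)
      · have := hI.progress
        exact { hI with progress := by omega })
  change Orienting G (s.reg 4) (Prog.orient.run s) at key
  rw [hT.rounds] at key
  have h₁ := key.queue.le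
  have h₂ := key.head_le
  have h₃ := key.next_le
  have h₄ := key.progress
  exact ⟨key.partialOrientation (by omega), fun {u v} huv =>
    key.total u v (by have := code_lt u v; omega) huv⟩

namespace Prog

/-- Counts the successors of the vertex in register `10` in register `12`. -/
def countSuccessors : Prog :=
  .loop 11 0 (.ite (.get 6 (.add (.get 2 (.reg 10)) (.reg 11)))
    (.assign 12 (.add (.reg 12) (.lit 1))) .skip)

/-- Computes array `8`. -/
def rightEnds : Prog :=
  .loop 10 0 <| .seq (.assign 12 (.lit 0)) <| .seq countSuccessors
    (.store 8 (.reg 10) (.sub (.reg 0) (.add (.reg 12) (.lit 1))))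

/-- Computes the minimum of register `12` and the right end points of the neighbours of the vertex
in register `10`. -/
def minNeighbour : Prog :=
  .loop 11 0 (.ite (.get 1 (.add (.get 2 (.reg 10)) (.reg 11)))
    (.ite (.sub (.reg 12) (.get 8 (.reg 11))) (.assign 12 (.get 8 (.reg 11))) .skip) .skip)

/-- Computes array `9`. -/
def leftEnds : Prog :=
  .loop 10 0 <| .seq (.assign 12 (.get 8 (.reg 10))) <| .seq minNeighbour
    (.store 9 (.reg 10) (.reg 12))

end Prog

/-! ### End points -/

section Filter

variable {n : ℕ}

theorem filter_lt_succ (F : Finset (Fin n)) (u : Fin n) :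
    F.filter (fun v => v.1 < u.1 + 1) =
      if u ∈ F then insert u (F.filter fun v => v.1 < u.1) else F.filter fun v => v.1 < u.1 := by
  ext v
  have : v.1 < u.1 + 1 ↔ v = u ∨ v.1 < u.1 := by rw [Fin.ext_iff]; omega
  split_ifs with h
  · simp only [Finset.mem_filter, Finset.mem_insert, this]
    by_cases hv : v = u
    · simp [hv, h]
    · simp [hv]
  · simp only [Finset.mem_filter, this]
    by_cases hv : v = u
    · simp [hv, h]
    · simp [hv]

theorem notMem_filter_lt (F : Finset (Fin n)) (u : Fin n) :
    u ∉ F.filter fun v => v.1 < u.1 := by simp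

theorem filter_lt_all (F : Finset (Fin n)) : F.filter (fun v => v.1 < n) = F :=
  Finset.filter_true_of_mem fun v _ => v.2

theorem filter_lt_zero (F : Finset (Fin n)) : F.filter (fun v => v.1 < 0) = ∅ := by simp

end Filter

open Classical in
theorem run_countSuccessors {n : ℕ} {G : SimpleGraph (Fin n)} {s : State} (hT : Tables G s)
    {u : Fin n} (hu : s.reg 10 = u) (h₁₂ : s.reg 12 = 0) :
    (Prog.countSuccessors.run s).reg 12 =
      (Finset.univ.filter fun v : Fin n => oriented s u v).card := by
  have key := Prog.run_loop (x := 11) (r := 0)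
    (p := .ite (.get 6 (.add (.get 2 (.reg 10)) (.reg 11)))
      (.assign 12 (.add (.reg 12) (.lit 1))) .skip)
    (fun i s' => s'.reg 12 =
      ((Finset.univ.filter fun v : Fin n => oriented s u v).filter fun v => v.1 < i).card) s
    (by simp [h₁₂]) (by
      intro i hi s' hF hr hI
      rw [hT.size] at hi
      have h₆ : s'.arr 6 = s.arr 6 := hF.arr 6 rfl
      have h₁₀ : s'.reg 10 = u := (hF.reg 10 rfl).trans hu
      have hb : s'.arr 2 u = u * n := (hT.frame hF rfl).base u
      have := filter_lt_succ (Finset.univ.filter fun v : Fin n => oriented s u v) ⟨i, hi⟩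
      simp only at this
      rw [this, State.reg_setReg, if_neg (by decide)]
      have hm : (⟨i, hi⟩ : Fin n) ∈ (Finset.univ.filter fun v : Fin n => oriented s u v) ↔
          s.arr 6 (u * n + i) ≠ 0 := by
        rw [Finset.mem_filter]
        simp [oriented, code]
      by_cases h : s.arr 6 (u * n + i) = 0
      · rw [if_neg (by rw [hm]; simpa using h),
          Prog.run_ite_neg (by simp [h₆, h₁₀, hb, hr, h])]
        exact hI
      · rw [if_pos (by rwa [hm]), Prog.run_ite_pos (by simp [h₆, h₁₀, hb, hr, h]),
          Finset.card_insert_of_notMem (by simp)]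
        simp [Prog.run, hI])
  rw [hT.size, filter_lt_all] at key
  exact key

open Classical in
theorem run_rightEnds {n : ℕ} {G : SimpleGraph (Fin n)} {s : State} (hT : Tables G s)
    (u : Fin n) : (Prog.rightEnds.run s).arr 8 u =
      n - ((Finset.univ.filter fun v : Fin n => oriented s u v).card + 1) := by
  have key := Prog.run_loop (x := 10) (r := 0) (p := .seq (.assign 12 (.lit 0)) <|
    .seq Prog.countSuccessors (.store 8 (.reg 10) (.sub (.reg 0) (.add (.reg 12) (.lit 1)))))
    (fun i s' => ∀ u : Fin n, u.1 < i → s'.arr 8 u =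
      n - ((Finset.univ.filter fun v : Fin n => oriented s u v).card + 1)) s
    (by intro u hu; omega) (by
      intro i hi s' hF hr hI u hu
      rw [hT.size] at hi
      have h₆ : s'.arr 6 = s.arr 6 := hF.arr 6 rfl
      have hT' := hT.frame hF rfl
      have hc := run_countSuccessors (s := s'.setReg 12 0) (u := ⟨i, hi⟩)
        (hT'.of_eq (by simp) (by simp) (by simp) (by simp)) (by simpa using hr) (by simp)
      have hF' := Prog.frame_run Prog.countSuccessors (s'.setReg 12 0)
      have e₁₀ : (Prog.countSuccessors.run (s'.setReg 12 0)).reg 10 = i :=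
        (hF'.reg 10 rfl).trans (by simpa using hr)
      have e₀ : (Prog.countSuccessors.run (s'.setReg 12 0)).reg 0 = n :=
        (hF'.reg 0 rfl).trans (by simpa using hT'.size)
      have e₈ : (Prog.countSuccessors.run (s'.setReg 12 0)).arr 8 = s'.arr 8 := hF'.arr 8 rfl
      simp only [Prog.run, Expr.eval, State.arr_setReg, State.arr_setArr_apply, e₁₀, e₀, e₈, hc,
        true_and]
      split_ifs with h
      · obtain rfl : u = ⟨i, hi⟩ := Fin.ext h
        unfold oriented
        rw [State.arr_setReg, h₆]
      · exact hI u (by omega))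
  exact key u (by rw [hT.size]; exact u.2)

/-- The value `c` is the minimum of `b u` and of the values of `b` at the neighbours of `u` that
are less than `i`. -/
structure IsMinNeighbour {n : ℕ} (G : SimpleGraph (Fin n)) (b : Fin n → ℕ) (u : Fin n) (i c : ℕ) :
    Prop where
  le : c ≤ b u
  le_adj : ∀ v : Fin n, v < i → G.Adj u v → c ≤ b v
  eq : c = b u ∨ ∃ v, G.Adj u v ∧ c = b v

theorem run_minNeighbour {n : ℕ} {G : SimpleGraph (Fin n)} {s : State} (hT : Tables G s)
    {u : Fin n} (hu : s.reg 10 = u) (h₁₂ : s.reg 12 = s.arr 8 u) :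
    IsMinNeighbour G (fun v => s.arr 8 v) u n ((Prog.minNeighbour.run s).reg 12) := by
  have key := Prog.run_loop (x := 11) (r := 0)
    (p := .ite (.get 1 (.add (.get 2 (.reg 10)) (.reg 11)))
    (.ite (.sub (.reg 12) (.get 8 (.reg 11))) (.assign 12 (.get 8 (.reg 11))) .skip) .skip)
    (fun i s' => IsMinNeighbour G (fun v => s.arr 8 v) u i (s'.reg 12)) s
    ⟨by simp [h₁₂], fun v hv => by omega, .inl (by simp [h₁₂])⟩ (by
      intro i hi s' hF hr hI
      rw [hT.size] at hi
      have h₈ : s'.arr 8 = s.arr 8 := hF.arr 8 rfl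
      have h₁₀ : s'.reg 10 = u := (hF.reg 10 rfl).trans hu
      have hb : s'.arr 2 u = u * n := (hT.frame hF rfl).base u
      have ha : s'.arr 1 (u * n + i) = _ := (hT.frame hF rfl).adj u ⟨i, hi⟩
      rw [State.reg_setReg, if_neg (by decide)]
      by_cases h : G.Adj u ⟨i, hi⟩
      · rw [if_pos h] at ha
        rw [Prog.run_ite_pos (by simp [h₁₀, hb, hr, ha])]
        by_cases hlt : s.arr 8 i < s'.reg 12
        · rw [Prog.run_ite_pos (by simp [hr, h₈]; omega)]
          have : ((Prog.assign 12 (.get 8 (.reg 11))).run s').reg 12 = s.arr 8 i := by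
            simp [Prog.run, hr, h₈]
          rw [this]
          refine ⟨hlt.le.trans hI.le, fun v hv huv => ?_, .inr ⟨_, h, rfl⟩⟩
          by_cases hvi : v.1 = i
          · simp [hvi]
          · exact hlt.le.trans (hI.le_adj v (by omega) huv)
        · rw [Prog.run_ite_neg (by simp [hr, h₈]; omega)]
          refine ⟨hI.le, fun v hv huv => ?_, hI.eq⟩
          by_cases hvi : v.1 = i
          · simp [hvi, Prog.run]; omega
          · exact hI.le_adj v (by omega) huv
      · rw [if_neg h] at ha
        rw [Prog.run_ite_neg (by simp [h₁₀, hb, hr, ha])]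
        refine ⟨hI.le, fun v hv huv => hI.le_adj v ?_ huv, hI.eq⟩
        have : v.1 ≠ i := by
          intro hvi
          obtain rfl : v = ⟨i, hi⟩ := Fin.ext hvi
          exact h huv
        omega)
  rw [hT.size] at key
  exact key

theorem run_leftEnds {n : ℕ} {G : SimpleGraph (Fin n)} {s : State} (hT : Tables G s)
    (u : Fin n) : IsMinNeighbour G (fun v => s.arr 8 v) u n ((Prog.leftEnds.run s).arr 9 u) := by
  have key := Prog.run_loop (x := 10) (r := 0) (p := .seq (.assign 12 (.get 8 (.reg 10))) <|
    .seq Prog.minNeighbour (.store 9 (.reg 10) (.reg 12)))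
    (fun i s' => ∀ u : Fin n, u.1 < i →
      IsMinNeighbour G (fun v => s.arr 8 v) u n (s'.arr 9 u)) s
    (by intro u hu; omega) (by
      intro i hi s' hF hr hI u hu
      rw [hT.size] at hi
      have h₈ : s'.arr 8 = s.arr 8 := hF.arr 8 rfl
      have hT' := hT.frame hF rfl
      have hc := run_minNeighbour (s := s'.setReg 12 (s.arr 8 i)) (u := ⟨i, hi⟩)
        (hT'.of_eq (by simp) (by simp) (by simp) (by simp)) (by simpa using hr) (by simp [h₈])
      have hF' := Prog.frame_run Prog.minNeighbour (s'.setReg 12 (s.arr 8 i))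
      have e₁₀ : (Prog.minNeighbour.run (s'.setReg 12 (s.arr 8 i))).reg 10 = i :=
        (hF'.reg 10 rfl).trans (by simpa using hr)
      have e₉ : (Prog.minNeighbour.run (s'.setReg 12 (s.arr 8 i))).arr 9 = s'.arr 9 :=
        hF'.arr 9 rfl
      simp only [Prog.run, Expr.eval, State.arr_setReg, State.arr_setArr_apply, hr, h₈, e₁₀, e₉,
        true_and]
      split_ifs with h
      · obtain rfl : u = ⟨i, hi⟩ := Fin.ext h
        simpa [h₈] using hc
      · exact hI u (by omega))
  exact key u (by rw [hT.size]; exact u.2)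

namespace Prog

/-- Updates one entry of the table of subset weights. -/
def addItemAt : Prog :=
  .seq (.assign 28 (.sub (.reg 5) (.add (.reg 25) (.lit 1)))) <|
    .ite (.sub (.add (.reg 28) (.lit 1)) (.get 0 (.reg 24)))
      (.ite (.get 10 (.sub (.reg 28) (.get 0 (.reg 24)))) (.store 10 (.reg 28) (.lit 1)) .skip)
      .skip

/-- Adds the vertex in register `24` to the set whose subset weights are tabulated. -/
def addItem : Prog := .loop 25 5 addItemAt

/-- Treats the vertex in register `24` if it lies between the cuts in registers `23` and `30` or
crosses the second one but not the first. -/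
def scanVertex : Prog :=
  .ite (.sub (.add (.get 9 (.reg 24)) (.lit 1)) (.reg 23))
    (.ite (.sub (.reg 30) (.get 8 (.reg 24)))
      (.seq (.assign 26 (.add (.reg 26) (.get 0 (.reg 24)))) addItem)
      (.ite (.sub (.reg 30) (.get 9 (.reg 24)))
        (.assign 27 (.add (.reg 27) (.get 0 (.reg 24)))) .skip))
    .skip

/-- Replaces register `29` by the value of an expression if this is smaller. -/
def improve (e : Expr) : Prog := .ite (.sub (.reg 29) e) (.assign 29 e) .skip

/-- Takes the subset weight in register `28` into account. -/
def consider : Prog :=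
  .ite (.get 10 (.reg 28))
    (.ite (.sub (.add (.reg 1) (.lit 1)) (.reg 2))
      (improve (.add (.reg 27) (.sub (.reg 26) (.reg 28))))
      (.ite (.sub (.add (.reg 2) (.lit 1)) (.sub (.reg 26) (.reg 28)))
        (improve (.add (.reg 27) (.reg 28))) .skip))
    .skip

/-- Starts the table of subset weights. -/
def clear : Prog :=
  .seq (.assign 26 (.lit 0)) <| .seq (.assign 27 (.get 11 (.reg 23))) <|
  .seq (.loop 25 5 (.store 10 (.reg 25) (.lit 0))) (.store 10 (.lit 0) (.lit 1))

/-- Takes the cut in register `23` as a predecessor of the cut in register `30` into account. -/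
def evalPair : Prog := .seq clear <| .seq (.loop 24 0 scanVertex) (.loop 28 5 consider)

/-- Computes the entry of array `11` for the successor of register `22`. -/
def evalCut : Prog :=
  .seq (.assign 30 (.add (.reg 22) (.lit 1))) <|
  .seq (.assign 29 (.add (.reg 1) (.lit 1))) <|
  .seq (.loop 23 0 (.ite (.sub (.reg 30) (.reg 23)) evalPair .skip)) (.store 11 (.reg 30) (.reg 29))

/-- The dynamic program. -/
def solve : Prog := .loop 22 0 evalCut

end Prog

/-! ### The dynamic program -/

section Solve

variable {n : ℕ} {a b w : Fin n → ℕ} {k l : ℕ}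

/-- The number `y` is the weight of a subset of `S`. -/
def SubsetWeight (w : Fin n → ℕ) (S : Finset (Fin n)) (y : ℕ) : Prop :=
  ∃ Y ⊆ S, ∑ u ∈ Y, w u = y

theorem subsetWeight_empty {y : ℕ} : SubsetWeight w ∅ y ↔ y = 0 := by
  constructor
  · rintro ⟨Y, hY, rfl⟩
    simp [Finset.subset_empty.1 hY]
  · rintro rfl
    exact ⟨∅, subset_rfl, by simp⟩

theorem subsetWeight_insert {S : Finset (Fin n)} {u : Fin n} (hu : u ∉ S) {y : ℕ} :
    SubsetWeight w (insert u S) y ↔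
      SubsetWeight w S y ∨ w u ≤ y ∧ SubsetWeight w S (y - w u) := by
  constructor
  · rintro ⟨Y, hY, rfl⟩
    by_cases h : u ∈ Y
    · have e := Finset.add_sum_erase Y w h
      refine .inr ⟨by omega, Y.erase u, ?_, by omega⟩
      rwa [← Finset.subset_insert_iff]
    · exact .inl ⟨Y, (Finset.subset_insert_iff_of_notMem h).1 hY, rfl⟩
  · rintro (⟨Y, hY, rfl⟩ | ⟨h, Y, hY, e⟩)
    · exact ⟨Y, hY.trans (Finset.subset_insert _ _), rfl⟩
    · refine ⟨insert u Y, Finset.insert_subset_insert _ hY, ?_⟩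
      rw [Finset.sum_insert fun h => hu (hY h)]
      omega

/-- The memory contents that the dynamic program only reads. -/
structure Data (a b w : Fin n → ℕ) (k l : ℕ) (s : State) : Prop where
  size : s.reg 0 = n
  budget : s.reg 1 = k
  limit : s.reg 2 = l
  capacity : s.reg 5 = min k l + 1
  weight : ∀ u : Fin n, s.arr 0 u = w u
  right : ∀ u : Fin n, s.arr 8 u = b u
  left : ∀ u : Fin n, s.arr 9 u = a u

theorem Data.of_eq {s s' : State} (h : Data a b w k l s) (h₀ : s'.reg 0 = s.reg 0)
    (h₁ : s'.reg 1 = s.reg 1) (h₂ : s'.reg 2 = s.reg 2) (h₅ : s'.reg 5 = s.reg 5)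
    (k₀ : s'.arr 0 = s.arr 0) (k₈ : s'.arr 8 = s.arr 8) (k₉ : s'.arr 9 = s.arr 9) :
    Data a b w k l s' :=
  ⟨h₀.trans h.size, h₁.trans h.budget, h₂.trans h.limit, h₅.trans h.capacity,
    by rw [k₀]; exact h.weight, by rw [k₈]; exact h.right, by rw [k₉]; exact h.left⟩

/-- A program does not write the memory that the dynamic program only reads. -/
def Prog.KeepsData (p : Prog) : Bool :=
  !p.writesReg 0 && !p.writesReg 1 && !p.writesReg 2 && !p.writesReg 5 && !p.writesArr 0 &&
    !p.writesArr 8 && !p.writesArr 9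

theorem Data.frame {s s' : State} (h : Data a b w k l s) {p : Prog} (hF : p.Frame s s')
    (hp : p.KeepsData = true) : Data a b w k l s' := by
  simp only [Prog.KeepsData, Bool.and_eq_true, Bool.not_eq_true'] at hp
  obtain ⟨⟨⟨⟨⟨⟨p₀, p₁⟩, p₂⟩, p₅⟩, q₀⟩, q₈⟩, q₉⟩ := hp
  exact h.of_eq (hF.reg _ p₀) (hF.reg _ p₁) (hF.reg _ p₂) (hF.reg _ p₅) (hF.arr _ q₀)
    (hF.arr _ q₈) (hF.arr _ q₉)

/-- Array `10` tabulates the weights of the subsets of `S` that are at most `min k l`. -/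
def Tabulated (w : Fin n → ℕ) (k l : ℕ) (S : Finset (Fin n)) (s : State) : Prop :=
  ∀ y < min k l + 1, s.arr 10 y ≠ 0 ↔ SubsetWeight w S y

theorem run_addItemAt {s : State} {u c m : ℕ} (h₂₄ : s.reg 24 = u) (hc : s.arr 0 u = c)
    (hm : s.reg 5 - (s.reg 25 + 1) = m) (y : ℕ) : (Prog.addItemAt.run s).arr 10 y =
      if y = m ∧ c ≤ m ∧ s.arr 10 (m - c) ≠ 0 then 1 else s.arr 10 y := by
  by_cases h₁ : c ≤ m
  · have h₁' : m + 1 - c ≠ 0 := by omega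
    by_cases h₂ : s.arr 10 (m - c) = 0 <;>
      simp [Prog.addItemAt, Prog.run, hm, h₂₄, hc, h₁, h₁', h₂]
  · have h₁' : m + 1 - c = 0 := by omega
    simp [Prog.addItemAt, Prog.run, hm, h₂₄, hc, h₁, h₁']

theorem run_addItem {s : State} (h : Data a b w k l s) {S : Finset (Fin n)} {u : Fin n}
    (hu : u ∉ S) (h₂₄ : s.reg 24 = u) (hS : Tabulated w k l S s) :
    Tabulated w k l (insert u S) (Prog.addItem.run s) := by
  have key := Prog.run_loop (x := 25) (r := 5) (p := Prog.addItemAt)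
    (fun i s' => ∀ y < min k l + 1, s'.arr 10 y ≠ 0 ↔
      SubsetWeight w (if min k l + 1 ≤ y + i then insert u S else S) y) s
    (by
      intro y hy
      rw [if_neg (by omega)]
      exact hS y hy) (by
      intro i hi s' hF hr hI
      have hD := h.frame hF rfl
      have e₂₄ : s'.reg 24 = u := (hF.reg 24 rfl).trans h₂₄
      rw [h.capacity] at hi
      obtain ⟨m, hm⟩ : ∃ m, m + (i + 1) = min k l + 1 := ⟨min k l - i, by omega⟩
      have hrun := run_addItemAt e₂₄ (hD.weight u) (m := m) (by rw [hr, hD.capacity]; omega)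
      intro y hy
      rw [State.arr_setReg, hrun]
      by_cases hym : y = m
      · subst hym
        have hold := hI y hy
        rw [if_neg (by omega)] at hold
        rw [if_pos (c := min k l + 1 ≤ y + (i + 1)) (by omega), subsetWeight_insert hu, ← hold]
        by_cases h₁ : w u ≤ y
        · have := hI (y - w u) (by omega)
          rw [if_neg (by omega)] at this
          rw [← this]
          by_cases h₂ : s'.arr 10 (y - w u) = 0
          · simp [h₂]
          · simp [h₁, h₂]
        · simp [h₁]
      · have : min k l + 1 ≤ y + i ↔ min k l + 1 ≤ y + (i + 1) := by omega
        rw [if_neg (by tauto), hI y hy]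
        simp only [this])
  intro y hy
  have := key y hy
  rwa [if_pos (by have := h.capacity; omega)] at this

/-- The state after the vertices less than `i` have been treated. -/
structure Scanned (a b w : Fin n → ℕ) (k l s t c i : ℕ) (σ : State) : Prop where
  table : Tabulated w k l ((region a b s t).filter fun v => v.1 < i) σ
  weight : σ.reg 26 = ∑ v ∈ (region a b s t).filter fun v => v.1 < i, w v
  cost : σ.reg 27 = c + ∑ v ∈ (crossing a b s t).filter fun v => v.1 < i, w v

theorem run_scanVertex {s t c : ℕ} {σ : State} (h : Data a b w k l σ) {u : Fin n}
    (hab : ∀ u, a u ≤ b u) (h₂₃ : σ.reg 23 = s) (h₃₀ : σ.reg 30 = t) (h₂₄ : σ.reg 24 = u)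
    (hs : Scanned a b w k l s t c u σ) :
    Scanned a b w k l s t c (u + 1) (Prog.scanVertex.run σ) := by
  have hau := hab u
  by_cases hs₁ : s ≤ a u
  · have e₁ : Prog.scanVertex.run σ = (Prog.ite (.sub (.reg 30) (.get 8 (.reg 24)))
        (.seq (.assign 26 (.add (.reg 26) (.get 0 (.reg 24)))) Prog.addItem)
        (.ite (.sub (.reg 30) (.get 9 (.reg 24)))
          (.assign 27 (.add (.reg 27) (.get 0 (.reg 24)))) .skip)).run σ :=
      Prog.run_ite_pos (by simp [h₂₃, h₂₄, h.left]; omega) _ _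
    rw [e₁]
    by_cases hb : b u < t
    · have hr : u ∈ region a b s t := by simp [hs₁, hb]
      have hc : u ∉ crossing a b s t := by simp; omega
      rw [Prog.run_ite_pos (by simp [h₃₀, h₂₄, h.right]; omega)]
      have hD : Data a b w k l (σ.setReg 26 (σ.reg 26 + w u)) :=
        h.of_eq (by simp) (by simp) (by simp) (by simp) rfl rfl rfl
      have hT := run_addItem hD (notMem_filter_lt (region a b s t) u) (by simpa using h₂₄) hs.table
      have hF := Prog.frame_run Prog.addItem (σ.setReg 26 (σ.reg 26 + w u))
      have e₂ : (Prog.seq (.assign 26 (.add (.reg 26) (.get 0 (.reg 24)))) Prog.addItem).run σ =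
          Prog.addItem.run (σ.setReg 26 (σ.reg 26 + w u)) := by
        simp only [Prog.run, Expr.eval, h₂₄, h.weight]
      rw [e₂]
      refine ⟨?_, ?_, ?_⟩
      · rwa [filter_lt_succ, if_pos hr]
      · rw [hF.reg 26 rfl, filter_lt_succ, if_pos hr, Finset.sum_insert (notMem_filter_lt _ _)]
        simp [hs.weight, add_comm]
      · rw [hF.reg 27 rfl, filter_lt_succ, if_neg hc]
        simpa using hs.cost
    · have hr : u ∉ region a b s t := by simp; omega
      rw [Prog.run_ite_neg (by simp [h₃₀, h₂₄, h.right]; omega)]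
      by_cases ha : a u < t
      · have hc : u ∈ crossing a b s t := by simp; omega
        rw [Prog.run_ite_pos (by simp [h₃₀, h₂₄, h.left]; omega)]
        refine ⟨?_, ?_, ?_⟩
        · rw [filter_lt_succ, if_neg hr]
          exact hs.table
        · rw [filter_lt_succ, if_neg hr]
          simpa [Prog.run] using hs.weight
        · rw [filter_lt_succ, if_pos hc, Finset.sum_insert (notMem_filter_lt _ _)]
          simp [Prog.run, hs.cost, h₂₄, h.weight]
          omega
      · have hc : u ∉ crossing a b s t := by simp; omega
        rw [Prog.run_ite_neg (by simp [h₃₀, h₂₄, h.left]; omega)]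
        refine ⟨?_, ?_, ?_⟩
        · rw [filter_lt_succ, if_neg hr]
          exact hs.table
        · rw [filter_lt_succ, if_neg hr]
          exact hs.weight
        · rw [filter_lt_succ, if_neg hc]
          exact hs.cost
  · have hr : u ∉ region a b s t := by simp; omega
    have hc : u ∉ crossing a b s t := by simp; omega
    have e₁ : Prog.scanVertex.run σ = σ :=
      Prog.run_ite_neg (by simp [h₂₃, h₂₄, h.left]; omega) _ _
    rw [e₁]
    refine ⟨?_, ?_, ?_⟩
    · rw [filter_lt_succ, if_neg hr]
      exact hs.table
    · rw [filter_lt_succ, if_neg hr]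
      exact hs.weight
    · rw [filter_lt_succ, if_neg hc]
      exact hs.cost

theorem run_clear {s t : ℕ} {σ : State} (h : Data a b w k l σ) (h₂₃ : σ.reg 23 = s) :
    Scanned a b w k l s t (σ.arr 11 s) 0 (Prog.clear.run σ) := by
  let σ₁ : State := (σ.setReg 26 0).setReg 27 (σ.arr 11 s)
  have hF := Prog.frame_run (.loop 25 5 (.store 10 (.reg 25) (.lit 0))) σ₁
  have key := Prog.run_loop (x := 25) (r := 5) (p := .store 10 (.reg 25) (.lit 0))
    (fun i s' => ∀ y < i, s'.arr 10 y = 0) σ₁ (by intro y hy; omega) (by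
      intro i hi s' hF hr hI y hy
      simp only [Prog.run, State.arr_setReg, State.arr_setArr_apply, Expr.eval, hr, true_and]
      split_ifs with h
      · rfl
      · exact hI y (by omega))
  have e : Prog.clear.run σ =
      ((Prog.loop 25 5 (.store 10 (.reg 25) (.lit 0))).run σ₁).setArr 10 0 1 := by
    rw [Prog.clear]
    generalize Prog.loop 25 5 (.store 10 (.reg 25) (.lit 0)) = p
    simp [Prog.run, σ₁, h₂₃]
  have e₅ : σ₁.reg 5 = min k l + 1 := by simp [σ₁, h.capacity]
  rw [e₅] at key
  rw [e]
  refine ⟨?_, ?_, ?_⟩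
  · intro y hy
    rw [filter_lt_zero, subsetWeight_empty, State.arr_setArr_apply]
    by_cases h0 : y = 0
    · simp [h0]
    · simp [h0, key y hy]
  · rw [filter_lt_zero, State.reg_setArr, hF.reg 26 rfl]
    simp [σ₁]
  · rw [filter_lt_zero, State.reg_setArr, hF.reg 27 rfl]
    simp [σ₁]

theorem run_improve {σ : State} (e : Expr) (c : ℕ) :
    ((Prog.improve e).run σ).reg 29 ≤ c ↔ σ.reg 29 ≤ c ∨ e.eval σ ≤ c := by
  by_cases h : σ.reg 29 - e.eval σ = 0
  · rw [Prog.improve, Prog.run_ite_neg (by simpa using h)]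
    simp only [Prog.run]
    omega
  · rw [Prog.improve, Prog.run_ite_pos (by simpa using h)]
    simp [Prog.run]
    omega

/-- The weight `y` of a subset of the region `S` yields a solution of weight at most `c`, where `d`
is the weight of the deleted vertices outside `S`. -/
def Candidate (w : Fin n → ℕ) (k l : ℕ) (S : Finset (Fin n)) (d c y : ℕ) : Prop :=
  SubsetWeight w S y ∧ (l ≤ k ∨ ∑ u ∈ S, w u - y ≤ l) ∧
    d + (if l ≤ k then ∑ u ∈ S, w u - y else y) ≤ c

theorem run_consider {σ : State} (h : Data a b w k l σ) {S : Finset (Fin n)} {d y : ℕ}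
    (hS : σ.arr 10 y ≠ 0 ↔ SubsetWeight w S y) (h₂₆ : σ.reg 26 = ∑ u ∈ S, w u)
    (h₂₇ : σ.reg 27 = d) (h₂₈ : σ.reg 28 = y) (c : ℕ) :
    (Prog.consider.run σ).reg 29 ≤ c ↔ σ.reg 29 ≤ c ∨ Candidate w k l S d c y := by
  rw [Candidate, ← hS, ← h₂₆]
  by_cases h₁ : σ.arr 10 y = 0
  · rw [Prog.consider, Prog.run_ite_neg (by simpa [h₂₈] using h₁)]
    simp [h₁, Prog.run]
  · rw [Prog.consider, Prog.run_ite_pos (by simpa [h₂₈] using h₁)]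
    by_cases h₂ : l ≤ k
    · rw [Prog.run_ite_pos (by simp [h.budget, h.limit]; omega), run_improve]
      simp [h₁, h₂, h₂₇, h₂₈]
    · rw [Prog.run_ite_neg (by simp [h.budget, h.limit]; omega)]
      by_cases h₃ : σ.reg 26 - y ≤ l
      · rw [Prog.run_ite_pos (by simp [h₂₈, h.limit]; omega), run_improve]
        simp only [Expr.eval, h₂₇, h₂₈]
        simp [h₁, h₂]
        omega
      · rw [Prog.run_ite_neg (by simp [h₂₈, h.limit]; omega)]
        simp only [Prog.run, h₂, h₃]
        simp

theorem run_evalPair {s t : ℕ} {σ : State} (h : Data a b w k l σ) (hab : ∀ u, a u ≤ b u)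
    (h₂₃ : σ.reg 23 = s) (h₃₀ : σ.reg 30 = t) (c : ℕ) :
    (Prog.evalPair.run σ).reg 29 ≤ c ↔ σ.reg 29 ≤ c ∨ ∃ y < min k l + 1,
      Candidate w k l (region a b s t) (σ.arr 11 s + ∑ u ∈ crossing a b s t, w u) c y := by
  have hF₁ := Prog.frame_run Prog.clear σ
  have hS₁ := run_clear (t := t) h h₂₃
  have hD₁ := h.frame hF₁ rfl
  have e : Prog.evalPair.run σ = (Prog.loop 28 5 Prog.consider).run
    ((Prog.loop 24 0 Prog.scanVertex).run (Prog.clear.run σ)) := rfl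
  rw [e]
  have g₂₃ := (hF₁.reg 23 rfl).trans h₂₃
  have g₃₀ := (hF₁.reg 30 rfl).trans h₃₀
  have g₂₉ := hF₁.reg 29 rfl
  generalize Prog.clear.run σ = σ₁ at *
  have hF₂ := Prog.frame_run (.loop 24 0 Prog.scanVertex) σ₁
  have hD₂ := hD₁.frame hF₂ rfl
  have hS₂ := Prog.run_loop (x := 24) (r := 0) (p := Prog.scanVertex)
    (Scanned a b w k l s t (σ.arr 11 s)) σ₁
    ⟨hS₁.table, by simpa using hS₁.weight, by simpa using hS₁.cost⟩ (by
      intro i hi s' hF hr hI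
      rw [hD₁.size] at hi
      have := run_scanVertex (u := ⟨i, hi⟩) (hD₁.frame hF rfl) hab ((hF.reg 23 rfl).trans g₂₃)
        ((hF.reg 30 rfl).trans g₃₀) hr hI
      exact ⟨this.table, by simpa using this.weight, by simpa using this.cost⟩)
  rw [hD₁.size] at hS₂
  have g₂₉' := (hF₂.reg 29 rfl).trans g₂₉
  generalize (Prog.loop 24 0 Prog.scanVertex).run σ₁ = σ₂ at *
  obtain ⟨k₁, k₂, k₃⟩ := hS₂
  rw [filter_lt_all] at k₁ k₂ k₃
  have key := Prog.run_loop (x := 28) (r := 5) (p := Prog.consider)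
    (fun i s' => s'.reg 29 ≤ c ↔ σ.reg 29 ≤ c ∨ ∃ y < i,
      Candidate w k l (region a b s t) (σ.arr 11 s + ∑ u ∈ crossing a b s t, w u) c y) σ₂
    (by simp [g₂₉']) (by
      intro i hi s' hF hr hI
      rw [hD₂.capacity] at hi
      have := run_consider (hD₂.frame hF rfl) (S := region a b s t)
        (y := i) (by rw [hF.arr 10 rfl]; exact k₁ i hi) ((hF.reg 26 rfl).trans k₂)
        ((hF.reg 27 rfl).trans k₃) hr c
      rw [State.reg_setReg, if_neg (by decide), this, hI, or_assoc]
      refine or_congr_right ?_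
      simp only [Nat.lt_succ_iff_lt_or_eq, or_and_right, exists_or, exists_eq_left])
  rwa [hD₂.capacity] at key

theorem run_evalCut {t : ℕ} {σ : State} (h : Data a b w k l σ) (hab : ∀ u, a u ≤ b u)
    (ht : t < n) (h₂₂ : σ.reg 22 = t)
    (hd : ∀ s < t + 1, ∀ c ≤ k, σ.arr 11 s ≤ c ↔ Achievable a b w l s c) :
    ∀ s < t + 2, ∀ c ≤ k, (Prog.evalCut.run σ).arr 11 s ≤ c ↔ Achievable a b w l s c := by
  let σ₁ : State := (σ.setReg 30 (t + 1)).setReg 29 (k + 1)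
  have hD₁ : Data a b w k l σ₁ := h.of_eq (by simp [σ₁]) (by simp [σ₁]) (by simp [σ₁])
    (by simp [σ₁]) rfl rfl rfl
  let p : Prog := .loop 23 0 (.ite (.sub (.reg 30) (.reg 23)) Prog.evalPair .skip)
  have hF := Prog.frame_run p σ₁
  have e : Prog.evalCut.run σ = (p.run σ₁).setArr 11 (t + 1) ((p.run σ₁).reg 29) := by
    have h₃₀ : (p.run σ₁).reg 30 = t + 1 := (Prog.run_reg rfl σ₁).trans (by simp [σ₁])
    have e₁ : (Prog.assign 29 (.add (.reg 1) (.lit 1))).run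
        ((Prog.assign 30 (.add (.reg 22) (.lit 1))).run σ) = σ₁ := by
      simp [Prog.run, σ₁, h₂₂, h.budget]
    change (p.run ((Prog.assign 29 (.add (.reg 1) (.lit 1))).run
      ((Prog.assign 30 (.add (.reg 22) (.lit 1))).run σ))).setArr 11
      ((p.run ((Prog.assign 29 (.add (.reg 1) (.lit 1))).run
        ((Prog.assign 30 (.add (.reg 22) (.lit 1))).run σ))).reg 30)
      ((p.run ((Prog.assign 29 (.add (.reg 1) (.lit 1))).run
        ((Prog.assign 30 (.add (.reg 22) (.lit 1))).run σ))).reg 29) = _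
    rw [e₁]
    rw [h₃₀]
  have key : ∀ c ≤ k, (p.run σ₁).reg 29 ≤ c ↔ Achievable a b w l (t + 1) c := by
    intro c hc
    rw [achievable_iff_of_le hab (Nat.succ_pos t) hc hd]
    have := Prog.run_loop (x := 23) (r := 0)
      (p := .ite (.sub (.reg 30) (.reg 23)) Prog.evalPair .skip)
      (fun i s' => s'.reg 29 ≤ c ↔ ∃ s < i, s < t + 1 ∧ ∃ y < min k l + 1,
        Candidate w k l (region a b s (t + 1))
          (σ.arr 11 s + ∑ u ∈ crossing a b s (t + 1), w u) c y) σ₁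
      (by simp [σ₁]; omega) (by
        intro i hi s' hF hr hI
        have h₃₀ : s'.reg 30 = t + 1 := (hF.reg 30 rfl).trans (by simp [σ₁])
        have h₁₁ : s'.arr 11 = σ.arr 11 := hF.arr 11 rfl
        rw [State.reg_setReg, if_neg (by decide)]
        simp only [Nat.lt_succ_iff_lt_or_eq (n := i), or_and_right, exists_or, exists_eq_left]
        by_cases hit : i < t + 1
        · rw [Prog.run_ite_pos (by simp [h₃₀, hr]; omega),
            run_evalPair (hD₁.frame hF rfl) hab hr h₃₀, hI, h₁₁]
          simp only [hit, true_and]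
        · rw [Prog.run_ite_neg (by simp [h₃₀, hr]; omega)]
          simp only [hit, false_and, or_false]
          exact hI)
    have e₀ : σ₁.reg 0 = n := hD₁.size
    rw [e₀] at this
    refine this.trans ?_
    constructor
    · rintro ⟨s, -, hs, hy⟩
      exact ⟨s, hs, hy⟩
    · rintro ⟨s, hs, hy⟩
      exact ⟨s, by omega, hs, hy⟩
  intro s hs c hc
  rw [e, State.arr_setArr_apply]
  by_cases hst : s = t + 1
  · rw [if_pos ⟨rfl, hst⟩, hst]
    exact key c hc
  · rw [if_neg (by tauto), hF.arr 11 rfl]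
    exact hd s (by omega) c hc

theorem run_solve {σ : State} (h : Data a b w k l σ) (hab : ∀ u, a u ≤ b u)
    (h₀ : σ.arr 11 0 = 0) :
    (Prog.solve.run σ).arr 11 n ≤ k ↔ Achievable a b w l n k := by
  have key := Prog.run_loop (x := 22) (r := 0) (p := Prog.evalCut)
    (fun t s' => ∀ s < t + 1, ∀ c ≤ k, s'.arr 11 s ≤ c ↔ Achievable a b w l s c) σ
    (by
      intro s hs c _
      obtain rfl : s = 0 := by omega
      simp [h₀, achievable_zero]) (by
      intro t ht s' hF hr hI
      rw [h.size] at ht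
      exact run_evalCut (h.frame hF rfl) hab ht hr hI)
  rw [h.size] at key
  exact key n (Nat.lt_succ_self n) k le_rfl

end Solve

namespace Prog

/-- The main part of the program. -/
def body : Prog := .seq tabulate <| .seq orient <| .seq rightEnds <| .seq leftEnds solve

end Prog

/-- The program. Its last step compares the entry of array `11` for the last cut with `k`. -/
def program : Cmd :=
  .seq Prog.prepare.compile <| .seq Prog.body.compile <|
    .assign 0 (.sub (.lit 1) (.sub (.get 11 (.reg 0)) (.reg 1)))

/-! ### Correctness -/

theorem inputState_adj {n : ℕ} {G : SimpleGraph (Fin n)} {w : Fin n → ℕ} {k l : ℕ}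
    [DecidableRel G.Adj] (u v : Fin n) :
    (inputState G w k l).arr 1 (code u v) = if G.Adj u v then 1 else 0 := by
  have : (∃ u' v' : Fin n, code u v = u'.1 * n + v'.1 ∧ G.Adj u' v') ↔ G.Adj u v := by
    constructor
    · rintro ⟨u', v', h, hadj⟩
      obtain ⟨rfl, rfl⟩ := code_inj.1 (h : code u v = code u' v')
      exact hadj
    · exact fun h => ⟨u, v, rfl, h⟩
  simp only [inputState, one_ne_zero, if_false, if_true, this]

open Classical in
theorem run_body {n : ℕ} {G : SimpleGraph (Fin n)} {w : Fin n → ℕ} {k l : ℕ}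
    (hG : IsIntervalGraph G) {σ : State} (h₀ : σ.reg 0 = n) (h₁ : σ.reg 1 = k) (h₂ : σ.reg 2 = l)
    (h₃ : σ.reg 3 = n * n) (h₄ : σ.reg 4 = n * n + n * n) (h₅ : σ.reg 5 = min k l + 1)
    (h₁₃ : σ.reg 13 = 0) (h₁₄ : σ.reg 14 = 0) (h₁₅ : σ.reg 15 = 0)
    (hw : ∀ u : Fin n, σ.arr 0 u = w u)
    (hadj : ∀ u v, σ.arr 1 (code u v) = if G.Adj u v then 1 else 0)
    (hb : ∀ u : Fin n, σ.arr 2 u = u * n) (h₆ : ∀ c, σ.arr 6 c = 0)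
    (h₁₁ : ∀ c, σ.arr 11 c = 0) :
    (Prog.body.run σ).arr 11 n ≤ k ↔ IsYesInstance G w k l := by
  have hT₁ := run_tabulate h₀ h₃ h₄ hadj hb
  have hF₁ := Prog.frame_run Prog.tabulate σ
  have e : Prog.body.run σ = Prog.solve.run (Prog.leftEnds.run (Prog.rightEnds.run
    (Prog.orient.run (Prog.tabulate.run σ)))) := rfl
  rw [e]
  have d : ∀ σ' : State, σ'.reg 0 = σ.reg 0 → σ'.reg 1 = σ.reg 1 → σ'.reg 2 = σ.reg 2 →
      σ'.reg 5 = σ.reg 5 → σ'.arr 0 = σ.arr 0 →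
      Data (fun u : Fin n => σ'.arr 9 u) (fun u => σ'.arr 8 u) w k l σ' :=
    fun σ' e₀ e₁ e₂ e₅ f₀ => ⟨e₀.trans h₀, e₁.trans h₁, e₂.trans h₂, e₅.trans h₅,
      by rw [f₀]; exact hw, fun _ => rfl, fun _ => rfl⟩
  obtain ⟨hD, hDt⟩ := run_orient hG hT₁ ((hF₁.reg 13 rfl).trans h₁₃)
    ((hF₁.reg 14 rfl).trans h₁₄) ((hF₁.reg 15 rfl).trans h₁₅)
    (by rw [hF₁.arr 6 rfl]; exact h₆)
  have hF₂ := Prog.frame_run Prog.orient (Prog.tabulate.run σ)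
  have hT₂ := hT₁.frame hF₂ rfl
  have hR := run_rightEnds hT₂
  have hF₃ := Prog.frame_run Prog.rightEnds (Prog.orient.run (Prog.tabulate.run σ))
  have hT₃ := hT₂.frame hF₃ rfl
  have hL := run_leftEnds hT₃
  have hF₄ := Prog.frame_run Prog.leftEnds
    (Prog.rightEnds.run (Prog.orient.run (Prog.tabulate.run σ)))
  have f₈ := hF₄.arr 8 rfl
  have hreg : ∀ y, Prog.tabulate.writesReg y = false → Prog.orient.writesReg y = false →
      Prog.rightEnds.writesReg y = false → Prog.leftEnds.writesReg y = false →
      (Prog.leftEnds.run (Prog.rightEnds.run (Prog.orient.run (Prog.tabulate.run σ)))).reg y =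
        σ.reg y := fun y k₁ k₂ k₃ k₄ =>
    (hF₄.reg y k₄).trans ((hF₃.reg y k₃).trans ((hF₂.reg y k₂).trans (hF₁.reg y k₁)))
  have harr : ∀ y, Prog.tabulate.writesArr y = false → Prog.orient.writesArr y = false →
      Prog.rightEnds.writesArr y = false → Prog.leftEnds.writesArr y = false →
      (Prog.leftEnds.run (Prog.rightEnds.run (Prog.orient.run (Prog.tabulate.run σ)))).arr y =
        σ.arr y := fun y k₁ k₂ k₃ k₄ =>
    (hF₄.arr y k₄).trans ((hF₃.arr y k₃).trans ((hF₂.arr y k₂).trans (hF₁.arr y k₁)))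
  have hd := d _ (hreg 0 rfl rfl rfl rfl) (hreg 1 rfl rfl rfl rfl) (hreg 2 rfl rfl rfl rfl)
    (hreg 5 rfl rfl rfl rfl) (harr 0 rfl rfl rfl rfl)
  have e₁₁ := harr 11 rfl rfl rfl rfl
  rw [f₈] at hd
  generalize Prog.leftEnds.run (Prog.rightEnds.run (Prog.orient.run (Prog.tabulate.run σ))) = σ₄
    at hd hL e₁₁
  generalize Prog.rightEnds.run (Prog.orient.run (Prog.tabulate.run σ)) = σ₃ at hd hL hR
  have hrep : IsRepresentation G (fun u : Fin n => σ₄.arr 9 u) (fun u => σ₃.arr 8 u) :=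
    hG.isRepresentation hD hDt (by simpa using hR) (fun u => (hL u).le)
      (fun u v huv => (hL u).le_adj v v.2 huv) (fun u => (hL u).eq)
  rw [run_solve hd hrep.le (by rw [e₁₁]; exact h₁₁ 0),
    achievable_iff_isYesInstance hrep fun u => ?_]
  have := u.2
  have := hR u
  omega

/-! ### Running time -/

theorem time_prepare {K : ℕ} {ρ : ℕ → ℕ} (h₀ : ρ 0 = K) :
    Prog.prepare.time ρ = 22 + 15 * K := by
  simp only [Prog.prepare, Prog.capacity, Prog.multiples, Prog.time, Expr.cost, h₀]
  ring

theorem time_body {K m : ℕ} {ρ : ℕ → ℕ} (h₀ : ρ 0 = K) (h₄ : ρ 4 = 2 * (K * K))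
    (h₅ : ρ 5 = 2 * m) : Prog.body.time ρ =
      30 + 82 * K + 260 * K ^ 2 + 128 * (K ^ 2 * m) + 207 * K ^ 3 + 64 * (m * K ^ 3) := by
  simp only [Prog.body, Prog.tabulate, Prog.tabulatePair, Prog.orient, Prog.processNext,
    Prog.propagateAt, Prog.pushForced, Prog.push, Prog.tryNext, Prog.rightEnds,
    Prog.countSuccessors, Prog.leftEnds, Prog.minNeighbour, Prog.solve, Prog.evalCut,
    Prog.evalPair, Prog.clear, Prog.scanVertex, Prog.addItem, Prog.addItemAt, Prog.consider,
    Prog.improve, Prog.time, Expr.cost, h₀, h₄, h₅]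
  ring

theorem time_le {K m : ℕ} (hK : 1 ≤ K) (hm : 1 ≤ m) :
    (22 + 15 * K) + ((30 + 82 * K + 260 * K ^ 2 + 128 * (K ^ 2 * m) + 207 * K ^ 3 +
      64 * (m * K ^ 3)) + 8) ≤ 1000 * (m * K ^ 3) := by
  have h₁ : 1 ≤ m * K ^ 3 := Nat.mul_pos hm (Nat.pow_pos hK)
  have h₂ : K ≤ K ^ 3 := Nat.le_self_pow (by decide) K
  have h₃ : K ^ 2 ≤ K ^ 3 := Nat.pow_le_pow_right hK (by decide)
  have h₄ : K ^ 3 ≤ m * K ^ 3 := Nat.le_mul_of_pos_left _ hm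
  have h₅ : K ^ 2 * m ≤ m * K ^ 3 := by
    rw [mul_comm]
    exact Nat.mul_le_mul_left m h₃
  omega

end WCOC

theorem mainTheorem4 :
    ∃ (P : WCOC.Cmd) (C : ℕ), ∀ (n : ℕ) (G : SimpleGraph (Fin n)) (w : Fin n → ℕ) (k l : ℕ),
      WCOC.IsIntervalGraph G →
        WCOC.DecidesWithin P G w k l (C * (max 1 (min k l) * max 1 n ^ 3)) := by
  classical
  refine ⟨WCOC.program, 1000, fun n G w k l hG => ?_⟩
  obtain ⟨σ, hσ⟩ : ∃ σ, σ = WCOC.inputState G w k l := ⟨_, rfl⟩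
  rw [WCOC.DecidesWithin, ← hσ]
  have r₀ : σ.reg 0 = n := by rw [hσ]; rfl
  have r₁ : σ.reg 1 = k := by rw [hσ]; rfl
  have r₂ : σ.reg 2 = l := by rw [hσ]; rfl
  have r₃ : σ.reg 3 = 0 := by rw [hσ]; rfl
  have r₁₃ : σ.reg 13 = 0 := by rw [hσ]; rfl
  have r₁₄ : σ.reg 14 = 0 := by rw [hσ]; rfl
  have r₁₅ : σ.reg 15 = 0 := by rw [hσ]; rfl
  have a₀ : ∀ u : Fin n, σ.arr 0 u = w u := by intro u; rw [hσ]; simp [WCOC.inputState]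
  have a₁ : ∀ u v : Fin n, σ.arr 1 (WCOC.code u v) = if G.Adj u v then 1 else 0 := by
    rw [hσ]; exact WCOC.inputState_adj
  have a₆ : ∀ c, σ.arr 6 c = 0 := by intro c; rw [hσ]; rfl
  have a₁₁ : ∀ c, σ.arr 11 c = 0 := by intro c; rw [hσ]; rfl
  obtain ⟨p₃, p₄, p₅, p₂⟩ := WCOC.run_prepare r₀ r₃
  rw [r₁, r₂] at p₅
  have hF := WCOC.Prog.frame_run WCOC.Prog.prepare σ
  obtain ⟨ρ, ρ₀, ρ₄, ρ₅⟩ : ∃ ρ : ℕ → ℕ, ρ 0 = max 1 n ∧ ρ 4 = 2 * (max 1 n * max 1 n) ∧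
      ρ 5 = 2 * max 1 (min k l) :=
    ⟨fun y => if y = 0 then max 1 n else if y = 4 then 2 * (max 1 n * max 1 n) else
      2 * max 1 (min k l), rfl, rfl, rfl⟩
  obtain ⟨t₁, x₁, l₁⟩ := WCOC.Prog.exec_compile (p := WCOC.Prog.prepare) rfl
    (wr := fun y => y != 0) rfl (by intro y hy; simp at hy; subst hy; rfl) (ρ := ρ) (s := σ)
    (by intro y hy; simp at hy; subst hy; rw [r₀, ρ₀]; exact le_max_right _ _)
  have hreg := hF.reg
  have harr := hF.arr
  have hbody := WCOC.run_body (w := w) (k := k) (l := l) hG ((hreg 0 rfl).trans r₀)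
    ((hreg 1 rfl).trans r₁) ((hreg 2 rfl).trans r₂) p₃ p₄ p₅ ((hreg 13 rfl).trans r₁₃)
    ((hreg 14 rfl).trans r₁₄) ((hreg 15 rfl).trans r₁₅) (by rw [harr 0 rfl]; exact a₀)
    (by rw [harr 1 rfl]; exact a₁) (fun u => p₂ u u.2) (by rw [harr 6 rfl]; exact a₆)
    (by rw [harr 11 rfl]; exact a₁₁)
  obtain ⟨t₂, x₂, l₂⟩ := WCOC.Prog.exec_compile (p := WCOC.Prog.body) rfl
    (wr := fun y => y != 0 && y != 4 && y != 5) rfl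
    (by
      intro y hy
      have : y = 0 ∨ y = 4 ∨ y = 5 := by by_contra! h; simp [h] at hy
      rcases this with rfl | rfl | rfl <;> rfl) (ρ := ρ) (s := WCOC.Prog.prepare.run σ)
    (by
      intro y hy
      have : y = 0 ∨ y = 4 ∨ y = 5 := by by_contra! h; simp [h] at hy
      rcases this with rfl | rfl | rfl
      · rw [hreg 0 rfl, r₀, ρ₀]
        exact le_max_right _ _
      · rw [p₄, ρ₄]
        have := Nat.mul_le_mul (le_max_right 1 n) (le_max_right 1 n)
        omega
      · rw [p₅, ρ₅]
        omega)
  have g₀ : (WCOC.Prog.body.run (WCOC.Prog.prepare.run σ)).reg 0 = n :=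
    (WCOC.Prog.run_reg rfl _).trans ((hreg 0 rfl).trans r₀)
  have g₁ : (WCOC.Prog.body.run (WCOC.Prog.prepare.run σ)).reg 1 = k :=
    (WCOC.Prog.run_reg rfl _).trans ((hreg 1 rfl).trans r₁)
  refine ⟨_, _, .seq x₁ (.seq x₂ (.assign _ _ _)), ?_, ?_, ?_⟩
  · rw [WCOC.time_prepare ρ₀] at l₁
    rw [WCOC.time_body ρ₀ ρ₄ ρ₅] at l₂
    refine le_trans ?_ (WCOC.time_le (le_max_left 1 n) (le_max_left 1 (min k l)))
    simp only [WCOC.Expr.cost]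
    omega
  · intro h
    have := hbody.2 h
    simp [g₀, g₁]
    omega
  · intro h
    have := mt hbody.1 h
    simp [g₀, g₁]
    omega
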